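/- **Outer bound for the $k$-user MAC with a cooperation facilitator (CF).** *Setting.* Logarithms are to base 2, information is in bits, and $[x]=\{1,\dots,\lfloor x\rfloor\}$ for real $x\ge 1$. Let $\mathcal X_1,\dots,\mathcal X_k,\mathcal Y$ be nonempty standard Borel spaces (for example finite or countable sets, or $\mathbb R$) and let $p(y|x_{[k]})$ be a Markov kernel from $\mathcal X_{[k]}=\prod_j\mathcal X_j$ to $\mathcal Y$; the channel is used without memory and without feedback. Let $b_j:\mathcal X_j\to\mathbb R_{\ge0}$ be measurable cost functions, $B_j\ge 0$ cost constraints, and $C_{\rm in}^j,C_{\rm out}^j\ge0$ the capacities of the links from encoder $j$ to the CF and back ($j\in[k]$). For $R\in\mathbb R^k_{\ge0}$ and integers $n,L\geq 0$, a $((2^{nR_1},\dots,2^{nR_k}),n,L)$-code consists of nonempty finite alphabets $\mathcal U_{j\ell},\mathcal V_{j\ell}$ ($j\in[k]$, $\ell\in[L]$) with $\sum_\ell\log|\mathcal U_{j\ell}|\le nC^j_{\rm in}$ and $\sum_\ell\log|\mathcal V_{j\ell}|\le nC^j_{\rm out}$; of maps $$\varphi_{j\ell}:[2^{nR_j}]\times\prod_{\ell'<\ell}\mathcal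 V_{j\ell'}\to\mathcal U_{j\ell},\qquad \psi_{j\ell}:\prod_{i=1}^k\prod_{\ell'\le\ell}\mathcal U_{i\ell'}\to\mathcal V_{j\ell},\qquad f_j:[2^{nR_j}]\times\prod_{\ell\le L}\mathcal V_{j\ell}\to\mathcal X_j^n,$$ where every $x_j^n$ in the range of $f_j$ satisfies $\sum_{t=1}^n b_j(x_{jt})\le nB_j$; and of a measurable decoder $g:\mathcal Y^n\to\prod_j[2^{nR_j}]$. For a message vector $w_{[k]}$, in round $\ell$ encoder $j$ sends $u_{j\ell}=\varphi_{j\ell}(w_j,v_{j1},\dots,v_{j,\ell-1})$ to the CF and receives $v_{j\ell}=\psi_{j\ell}\big((u_{i1},\dots,u_{i\ell})_{i\in[k]}\big)$; after $L$ rounds it transmits $f_j(w_j,v_{j1},\dots,v_{jL})$ over the channel. The error probability $P_e^{(n)}$ is the probability that $g(Y^n)\ne W_{[k]}$ for $W_{[k]}$ uniform on $\prod_j[2^{nR_j}]$. The vector $R$ is achievable if there is a sequence of such codes, one for each $n$, with arbitrary numbers of rounds $L=L_n$, with $P_e^{(n)}\to0$. The capacity region $\mathscr C(\mathbf C_{\rm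 in},\mathbf C_{\rm out})$ is the closure of the set of achievable rate vectors. Let $\mathscr R_{\rm out}$ be the set of all $R\in\mathbb R^k_{\ge0}$ for which there are a finite set $\mathcal U_0$ and a distribution $p(u_0)\prod_{j}p(x_j|u_0)$ on $\mathcal U_0\times\mathcal X_{[k]}$ such that, with $Y$ the channel output for input $X_{[k]}$ (so that $U_0\to X_{[k]}\to Y$ is a Markov chain), $\mathbb E[b_j(X_j)]\le B_j$ for all $j\in[k]$ and $$\sum_{j\in S}R_j\le I(X_S;Y|U_0,X_{S^c})+\sum_{j\in S}C^j_{\rm in}\quad\text{for all }\emptyset\ne S\subseteq[k],\qquad \sum_{j\in[k]}R_j\le I(X_{[k]};Y).$$ *Proposition (Outer Bound).* $\mathscr C(\mathbf C_{\rm in},\mathbf C_{\rm out})\subseteq\overline{\mathscr R_{\rm out}}$, where the bar denotes closure. If moreover $\mathcal X_1,\dots,\mathcal X_k$ are all finite (with $\mathcal Y$ arbitrary), then $\mathscr C(\mathbf C_{\rm in},\mathbf C_{\rm out})\subseteq\mathscr R_{\rm out}$. -/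

import Mathlib

open MeasureTheory ProbabilityTheory Filter Topology
open scoped NNReal ENNReal

namespace MACCF

/-! ### Mutual information, in bits -/

section Information

variable {Ω α β γ : Type*} [MeasurableSpace Ω] [MeasurableSpace α] [MeasurableSpace β]
  [MeasurableSpace γ]

/-- Mutual information `I(A;B)` in bits: the divergence of the joint law of `(A, B)` from the
product of the marginal laws (`klDiv` uses the natural logarithm). -/
noncomputable def mutualInfo (P : Measure Ω) (A : Ω → α) (B : Ω → β) : ℝ≥0∞ :=
  InformationTheory.klDiv (P.map fun ω => (A ω, B ω)) ((P.map A).prod (P.map B)) /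
    ENNReal.ofReal (Real.log 2)

/-- Conditional mutual information `I(A;B|C)` in bits: the divergence of the joint law of
`(C, A, B)` from `P_C P_{A|C} P_{B|C}`. -/
noncomputable def condMutualInfo [StandardBorelSpace α] [Nonempty α] [StandardBorelSpace β]
    [Nonempty β] (P : Measure Ω) [IsFiniteMeasure P] (A : Ω → α) (B : Ω → β) (C : Ω → γ) :
    ℝ≥0∞ :=
  InformationTheory.klDiv (P.map fun ω => (C ω, (A ω, B ω)))
      (Measure.compProd (P.map C) (Kernel.prod (condDistrib A C P) (condDistrib B C P))) /
    ENNReal.ofReal (Real.log 2)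

end Information

/-! ### Codes for the MAC with a cooperation facilitator -/

section Coding

variable {k : ℕ} {X : Fin k → Type*} {Y : Type*} [∀ j, MeasurableSpace (X j)] [MeasurableSpace Y]

/-- The number of messages `⌊2^{nr}⌋` of an encoder of rate `r` at blocklength `n`. -/
noncomputable def numMessages (n : ℕ) (r : ℝ≥0) : ℕ := ⌊(2 : ℝ) ^ ((n : ℝ) * (r : ℝ))⌋₊

/-- A `((2^{nR_1}, …, 2^{nR_k}), n, L)`-code for a MAC with input alphabets `X j` and output
alphabet `Y`, cost functions `b j`, cost constraints `B j`, and a `(Cin, Cout)`-CF.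
Encoder `j` and the CF exchange symbols in rounds `ℓ : Fin L`, over alphabets of sizes
`sizeU j ℓ` (to the CF) and `sizeV j ℓ` (from the CF). -/
structure Code (Y : Type*) [MeasurableSpace Y] (b : ∀ j, X j → ℝ≥0) (Cin Cout B : Fin k → ℝ≥0)
    (R : Fin k → ℝ≥0) (n L : ℕ) where
  sizeU : Fin k → Fin L → ℕ
  sizeV : Fin k → Fin L → ℕ
  sizeU_pos : ∀ j ℓ, 0 < sizeU j ℓ
  sizeV_pos : ∀ j ℓ, 0 < sizeV j ℓ
  link_in : ∀ j, ∑ ℓ, Real.logb 2 (sizeU j ℓ) ≤ n * (Cin j : ℝ)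
  link_out : ∀ j, ∑ ℓ, Real.logb 2 (sizeV j ℓ) ≤ n * (Cout j : ℝ)
  /-- What encoder `j` sends in round `ℓ`, given its message and what it received from the CF in
  the earlier rounds. -/
  φ : ∀ (j : Fin k) (ℓ : Fin L), Fin (numMessages n (R j)) →
    (∀ ℓ' : Set.Iio ℓ, Fin (sizeV j ℓ')) → Fin (sizeU j ℓ)
  /-- What the CF sends to encoder `j` in round `ℓ`, given all it received in rounds up to and
  including `ℓ`. -/
  ψ : ∀ (j : Fin k) (ℓ : Fin L), (∀ i, ∀ ℓ' : Set.Iic ℓ, Fin (sizeU i ℓ')) → Fin (sizeV j ℓ)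
  /-- The channel encoders. -/
  f : ∀ j, Fin (numMessages n (R j)) → (∀ ℓ, Fin (sizeV j ℓ)) → Fin n → X j
  /-- The cost constraints, on every codeword in the range of `f j`. -/
  cost_le : ∀ j w v, ∑ t, b j (f j w v t) ≤ n * B j
  /-- The decoder. -/
  g : (Fin n → Y) → ∀ j, Fin (numMessages n (R j))
  measurable_g : Measurable g

namespace Code

variable {b : ∀ j, X j → ℝ≥0} {Cin Cout B R : Fin k → ℝ≥0} {n L : ℕ}

/-- The symbol `v_{jℓ}` that encoder `j` receives from the CF in round `ℓ` when the message vector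
is `w`, where `v_{jℓ} = ψ_{jℓ}(u_1^ℓ, …, u_k^ℓ)` and `u_{iℓ} = φ_{iℓ}(w_i, v_i^{ℓ-1})`. -/
def received (c : Code Y b Cin Cout B R n L) (w : ∀ j, Fin (numMessages n (R j)))
    (ℓ : Fin L) (j : Fin k) : Fin (c.sizeV j ℓ) :=
  c.ψ j ℓ fun i ℓ' => c.φ i ℓ' (w i) fun ℓ'' => received c w ℓ'' i
termination_by ℓ.val
decreasing_by
  have h1 : ℓ''.val < ℓ'.val := ℓ''.2
  have h2 : ℓ'.val ≤ ℓ := ℓ'.2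
  exact lt_of_lt_of_le h1 h2

/-- The vector of channel inputs at time `t` when the message vector is `w`. -/
def channelInput (c : Code Y b Cin Cout B R n L) (w : ∀ j, Fin (numMessages n (R j)))
    (t : Fin n) (j : Fin k) : X j :=
  c.f j (w j) (fun ℓ => c.received w ℓ j) t

/-- The average error probability over the memoryless channel `W`, for a message vector that is
uniform on `∏ j, [2^{nR_j}]`. -/
noncomputable def errorProb (W : Kernel (∀ j, X j) Y) (c : Code Y b Cin Cout B R n L) : ℝ≥0∞ :=
  (∑ w : ∀ j, Fin (numMessages n (R j)),
      Measure.pi (fun t => W (c.channelInput w t)) {y | c.g y ≠ w}) /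
    (Fintype.card (∀ j, Fin (numMessages n (R j))) : ℝ≥0∞)

end Code

/-- The rate vector `R` is achievable: there are codes, one for each blocklength `n`, with any
numbers of cooperation rounds, whose error probabilities tend to zero. -/
def Achievable (W : Kernel (∀ j, X j) Y) (b : ∀ j, X j → ℝ≥0) (Cin Cout B : Fin k → ℝ≥0)
    (R : Fin k → ℝ≥0) : Prop :=
  ∃ (L : ℕ → ℕ) (c : ∀ n, Code Y b Cin Cout B R n (L n)),
    Tendsto (fun n => (c n).errorProb W) atTop (𝓝 0)

/-- The capacity region: the closure of the set of achievable rate vectors. -/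
def capacityRegion (W : Kernel (∀ j, X j) Y) (b : ∀ j, X j → ℝ≥0) (Cin Cout B : Fin k → ℝ≥0) :
    Set (Fin k → ℝ≥0) :=
  closure {R | Achievable W b Cin Cout B R}

end Coding

/-! ### The outer region -/

section Outer

variable {k : ℕ} {X : Fin k → Type*} {Y : Type*} [∀ j, MeasurableSpace (X j)] [MeasurableSpace Y]

/-- The conditional law `∏_j p(x_j | u_0)` of the channel inputs, where `u_0` ranges over a finite
alphabet with `m` elements. -/
noncomputable def inputKernel {m : ℕ} (p : Fin m → ∀ j, ProbabilityMeasure (X j)) :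
    Kernel (Fin m) (∀ j, X j) :=
  Kernel.ofFunOfCountable fun u => Measure.pi fun j => (p u j : Measure (X j))

instance {m : ℕ} (p : Fin m → ∀ j, ProbabilityMeasure (X j)) : IsMarkovKernel (inputKernel p) :=
  ⟨fun u => by
    change IsProbabilityMeasure (Measure.pi fun j => (p u j : Measure (X j)))
    infer_instance⟩

/-- The joint law `p(u_0) ∏_j p(x_j | u_0) p(y | x_[k])` of `((U_0, X_[k]), Y)`. -/
noncomputable def jointLaw {m : ℕ} (q : ProbabilityMeasure (Fin m))
    (p : Fin m → ∀ j, ProbabilityMeasure (X j)) (W : Kernel (∀ j, X j) Y) :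
    Measure ((Fin m × ∀ j, X j) × Y) :=
  Measure.compProd (Measure.compProd (q : Measure (Fin m)) (inputKernel p))
    (W.comap Prod.snd measurable_snd)

instance {m : ℕ} (q : ProbabilityMeasure (Fin m)) (p : Fin m → ∀ j, ProbabilityMeasure (X j))
    (W : Kernel (∀ j, X j) Y) [IsMarkovKernel W] : IsProbabilityMeasure (jointLaw q p W) := by
  unfold jointLaw
  infer_instance

variable [∀ j, StandardBorelSpace (X j)] [∀ j, Nonempty (X j)] [StandardBorelSpace Y] [Nonempty Y]

/-- The rate vectors that, for some finite alphabet of `U_0` and some distribution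
`p(u_0) ∏_j p(x_j | u_0)` satisfying the cost constraints, satisfy
`∑_{j ∈ S} R_j ≤ I(X_S; Y | U_0, X_{S^c}) + ∑_{j ∈ S} Cin_j` for every nonempty `S`, and
`∑_j R_j ≤ I(X_[k]; Y)`. -/
def outerRegion (W : Kernel (∀ j, X j) Y) [IsMarkovKernel W] (b : ∀ j, X j → ℝ≥0)
    (Cin B : Fin k → ℝ≥0) : Set (Fin k → ℝ≥0) :=
  {R | ∃ (m : ℕ) (q : ProbabilityMeasure (Fin m)) (p : Fin m → ∀ j, ProbabilityMeasure (X j)),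
    (∀ j, ∫⁻ ω, (b j (ω.1.2 j) : ℝ≥0∞) ∂(jointLaw q p W) ≤ (B j : ℝ≥0∞)) ∧
    (∀ S : Finset (Fin k), S.Nonempty →
      ((∑ j ∈ S, R j : ℝ≥0) : ℝ≥0∞) ≤
        condMutualInfo (jointLaw q p W) (fun ω => S.restrict ω.1.2) (fun ω => ω.2)
            (fun ω => (ω.1.1, (Sᶜ).restrict ω.1.2)) +
          ((∑ j ∈ S, Cin j : ℝ≥0) : ℝ≥0∞)) ∧
    ((∑ j, R j : ℝ≥0) : ℝ≥0∞) ≤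
      mutualInfo (jointLaw q p W) (fun ω => ω.1.2) (fun ω => ω.2)}

end Outer

end MACCF

/-! For a code of blocklength `n`, let `U_0` consist of a uniform time `t` and the transcript `τ` of
all symbols sent to the CF. The transcript fixes every reply of the CF, so a message vector produces
`τ` exactly when each message separately is compatible with `τ` (`Code.sent_eq_iff`). The message
vectors with a given transcript thus form a product set, and uniform messages make the channel
inputs conditionally independent given `U_0` (`Code.inputLaw_eq_empirical`).

The rate bounds come from a change of measure instead of Fano's inequality and entropy chain rules.
Given `w`, the output has law `P w = ∏_t W(x_t)`; compare it with `Q w = ∏_t Q_t`, where `Q_t` is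
the output law given `U_0` and the inputs outside `S`. The law `Q w` depends on `w` only through a
key: the symbols sent by `S` and the messages outside `S`. Under laws with so few values decoding
rarely succeeds, which forces the average divergence of `P w` from `Q w` to be about `log (|M| /
|K|)`, for `|M|` message vectors and `|K|` keys (`decoder_le_sum_klDiv`). The divergence splits over
time, and its average is exactly `n I(X_S; Y | U_0, X_{S^c})` (`condMutualInfo_jointLaw`), while
`log (|M| / |K|)` is at least about `n ∑_{j ∈ S} (R j - Cin j)`. A trivial key with the marginal
output law gives the bound by `I(X_[k]; Y)`. The losses vanish as `n → ∞`, so slightly shrunken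
multiples of `R` lie in the outer region.

For finite input alphabets the outer region is closed (`isClosed_outerRegion`). It is cut out by
closed constraints on the convex hull of the profiles of independent inputs, and this hull is
compact by Carathéodory's theorem and the continuity of mutual information in the input weights, for
any output space. -/

namespace MACCF

/-! ### Divergence: product laws, a variational lower bound, kernels with a common input law. -/

section Divergence

open InformationTheory

variable {α β : Type*} [MeasurableSpace α] [MeasurableSpace β]

theorem klDiv_map_measurableEquiv (e : α ≃ᵐ β) (μ ν : Measure α) [IsFiniteMeasure μ]
    [IsFiniteMeasure ν] : klDiv (μ.map e) (ν.map e) = klDiv μ ν := by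
  refine le_antisymm (klDiv_map_le μ ν e.measurable) ?_
  have h := klDiv_map_le (μ.map e) (ν.map e) e.symm.measurable
  rwa [Measure.map_map e.symm.measurable e.measurable,
    Measure.map_map e.symm.measurable e.measurable, e.symm_comp_self, Measure.map_id,
    Measure.map_id] at h

theorem klDiv_prod (μ μ' : Measure α) (ν ν' : Measure β) [IsProbabilityMeasure μ]
    [IsProbabilityMeasure μ'] [IsProbabilityMeasure ν] [IsProbabilityMeasure ν'] :
    klDiv (μ.prod ν) (μ'.prod ν') = klDiv μ μ' + klDiv ν ν' := by
  have h := klDiv_compProd_eq_add μ μ' (Kernel.const α ν) (Kernel.const α ν')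
  rw [Measure.compProd_const, Measure.compProd_const, Measure.compProd_const] at h
  rw [h]
  congr 1
  rw [← klDiv_compProd_left ν ν' (Kernel.const β μ), Measure.compProd_const,
    Measure.compProd_const, ← klDiv_map_measurableEquiv MeasurableEquiv.prodComm]
  exact congrArg₂ klDiv Measure.prod_swap Measure.prod_swap

theorem klDiv_pi {n : ℕ} {α : Fin n → Type*} [∀ i, MeasurableSpace (α i)]
    (μ ν : ∀ i, Measure (α i)) [∀ i, IsProbabilityMeasure (μ i)]
    [∀ i, IsProbabilityMeasure (ν i)] :
    klDiv (Measure.pi μ) (Measure.pi ν) = ∑ i, klDiv (μ i) (ν i) := by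
  induction n with
  | zero =>
    rw [Measure.pi_of_empty μ, Measure.pi_of_empty ν]
    simp
  | succ n ih =>
    rw [← klDiv_map_measurableEquiv (MeasurableEquiv.piFinSuccAbove α 0),
      (measurePreserving_piFinSuccAbove μ 0).map_eq,
      (measurePreserving_piFinSuccAbove ν 0).map_eq, klDiv_prod, ih, Fin.sum_univ_succ]
    rfl

/-- Fenchel–Young inequality for `klFun`, with equality at `a = log x`; it reduces to `log s ≤ s -
1` at `s = exp a / x`. -/
theorem mul_sub_exp_le_klFun {x : ℝ} (hx : 0 ≤ x) (a : ℝ) :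
    x * a + 1 - Real.exp a ≤ klFun x := by
  rw [klFun_apply]
  rcases hx.eq_or_lt with rfl | hx
  · simp [(Real.exp_pos a).le]
  · have h := Real.log_le_sub_one_of_pos (div_pos (Real.exp_pos a) hx)
    rw [Real.log_div (Real.exp_pos a).ne' hx.ne', Real.log_exp] at h
    have h2 : x * (a - Real.log x) ≤ x * (Real.exp a / x - 1) := mul_le_mul_of_nonneg_left h hx.le
    rw [mul_sub, mul_sub, mul_div_cancel₀ _ hx.ne'] at h2
    linarith

/-- Integrate the Fenchel–Young bound for the density over `A`, and use `klFun ≥ 0` off `A`. The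
extra term `ν.real A` is dropped. -/
theorem mul_measureReal_sub_exp_le_klDiv (μ ν : Measure α) [IsFiniteMeasure μ]
    [IsFiniteMeasure ν] {A : Set α} (hA : MeasurableSet A) (a : ℝ) :
    ENNReal.ofReal (a * μ.real A - Real.exp a * ν.real A) ≤ klDiv μ ν := by
  by_cases h : klDiv μ ν = ∞
  · simp [h]
  obtain ⟨hac, hint⟩ := klDiv_ne_top_iff.1 h
  rw [← ENNReal.ofReal_toReal h]
  refine ENNReal.ofReal_le_ofReal ?_
  rw [toReal_klDiv_eq_integral_klFun hac]
  have hi : Integrable (fun x => A.indicator (fun x => (μ.rnDeriv ν x).toReal * a + 1 - Real.exp a)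
      x) ν :=
    (((Measure.integrable_toReal_rnDeriv.mul_const a).add (integrable_const 1)).sub
      (integrable_const _)).indicator hA
  calc a * μ.real A - Real.exp a * ν.real A
      ≤ ∫ x, A.indicator (fun x => (μ.rnDeriv ν x).toReal * a + 1 - Real.exp a) x ∂ν := by
        rw [integral_indicator hA, integral_sub, integral_add, integral_mul_const,
          Measure.setIntegral_toReal_rnDeriv hac]
        · simp only [integral_const, measureReal_restrict_apply_univ, smul_eq_mul]
          nlinarith [measureReal_nonneg (μ := ν) (s := A)]
        · exact (Measure.integrable_toReal_rnDeriv.mul_const a).integrableOn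
        · exact integrable_const _
        · exact ((Measure.integrable_toReal_rnDeriv.mul_const a).add
            (integrable_const 1)).integrableOn
        · exact integrable_const _
    _ ≤ ∫ x, klFun (μ.rnDeriv ν x).toReal ∂ν := by
        refine integral_mono hi ((integrable_klFun_rnDeriv_iff hac).2 hint) fun x => ?_
        by_cases hx : x ∈ A
        · simpa [hx] using mul_sub_exp_le_klFun ENNReal.toReal_nonneg a
        · simpa [hx] using klFun_nonneg ENNReal.toReal_nonneg

theorem klDiv_compProd_right [MeasurableSpace.CountableOrCountablyGenerated α β]
    (μ : Measure α) (κ η : Kernel α β) [IsFiniteMeasure μ] [IsFiniteKernel κ]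
    [IsFiniteKernel η] :
    klDiv (μ ⊗ₘ κ) (μ ⊗ₘ η) = ∫⁻ x, klDiv (κ x) (η x) ∂μ := by
  by_cases hac : ∀ᵐ x ∂μ, κ x ≪ η x
  · rw [klDiv_eq_lintegral_klFun_of_ac (Measure.AbsolutelyContinuous.compProd_right hac)]
    have h1 : (μ ⊗ₘ κ).rnDeriv (μ ⊗ₘ η) =ᵐ[μ ⊗ₘ η] fun p => κ.rnDeriv η p.1 p.2 := by
      have hκ : κ =ᵐ[μ] η.withDensity (κ.rnDeriv η) := by
        filter_upwards [hac] with x hx using (Kernel.withDensity_rnDeriv_eq hx).symm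
      rw [Measure.compProd_congr hκ, Measure.compProd_withDensity (Kernel.measurable_rnDeriv κ η)]
      exact Measure.rnDeriv_withDensity _ (Kernel.measurable_rnDeriv κ η)
    rw [lintegral_congr_ae (g := fun p => ENNReal.ofReal (klFun (κ.rnDeriv η p.1 p.2).toReal))
      (by filter_upwards [h1] with p hp using by rw [hp]), Measure.lintegral_compProd]
    · refine lintegral_congr_ae ?_
      filter_upwards [hac] with x hx
      rw [klDiv_eq_lintegral_klFun_of_ac hx]
      refine lintegral_congr_ae ?_
      filter_upwards [Kernel.rnDeriv_eq_rnDeriv_measure (κ := κ) (η := η) (a := x)] with y hy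
      rw [hy]
    · have := Kernel.measurable_rnDeriv κ η
      fun_prop
  -- If absolute continuity fails on a non-null set of inputs, both sides are infinite.
  · rw [klDiv_of_not_ac fun h => hac h.kernel_of_compProd]
    symm
    have hm := Kernel.measurableSet_absolutelyContinuous κ η
    have hpos : μ {x | κ x ≪ η x}ᶜ ≠ 0 := fun h => hac (ae_iff.2 h)
    refine top_le_iff.1 ?_
    calc ∞ = ∫⁻ x, {x | κ x ≪ η x}ᶜ.indicator (fun _ => ∞) x ∂μ := by
          rw [lintegral_indicator hm.compl, setLIntegral_const, ENNReal.top_mul hpos]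
      _ ≤ ∫⁻ x, klDiv (κ x) (η x) ∂μ := by
          refine lintegral_mono fun x => ?_
          by_cases hx : κ x ≪ η x
          · simp [hx]
          · simp [klDiv_of_not_ac hx]

theorem measurable_klDiv [MeasurableSpace.CountableOrCountablyGenerated α β]
    (κ η : Kernel α β) [IsFiniteKernel κ] [IsFiniteKernel η] :
    Measurable fun x => klDiv (κ x) (η x) := by
  have hr := Kernel.measurable_rnDeriv κ η
  have hm := Kernel.measurableSet_absolutelyContinuous κ η
  have hF : Measurable fun z : α × β => ENNReal.ofReal (klFun (κ.rnDeriv η z.1 z.2).toReal) := by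
    fun_prop
  have h : (fun x => klDiv (κ x) (η x)) = fun x => open Classical in
      if x ∈ {x | κ x ≪ η x} then
        ∫⁻ y, (fun z : α × β => ENNReal.ofReal (klFun (κ.rnDeriv η z.1 z.2).toReal)) (x, y) ∂η x
      else ∞ := by
    ext x
    by_cases hx : κ x ≪ η x
    · rw [if_pos (show x ∈ {x | κ x ≪ η x} from hx), klDiv_eq_lintegral_klFun_of_ac hx]
      refine lintegral_congr_ae ?_
      filter_upwards [Kernel.rnDeriv_eq_rnDeriv_measure (κ := κ) (η := η) (a := x)] with y hy
      rw [hy]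
    · rw [if_neg (show x ∉ {x | κ x ≪ η x} from hx), klDiv_of_not_ac hx]
  rw [h]
  exact Measurable.ite hm (Measurable.lintegral_kernel_prod_right' hF) measurable_const

end Divergence

/-! ### Mutual informations as average divergences of channel outputs. -/

section SingleLetter

open InformationTheory

variable {Ω α β γ : Type*} [MeasurableSpace Ω] [MeasurableSpace α] [MeasurableSpace β]
  [MeasurableSpace γ]

/-- If `B` is the output of the channel `η` for the input `A`, then `I(A;B)` is the average
divergence of the conditional laws of the output from the law of the output. -/
theorem mutualInfo_eq_lintegral [StandardBorelSpace β] {P : Measure Ω} [IsProbabilityMeasure P]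
    {A : Ω → α} {B : Ω → β} (hA : Measurable A) (η : Kernel α β)
    [IsMarkovKernel η] (h : P.map (fun ω => (A ω, B ω)) = P.map A ⊗ₘ η) :
    mutualInfo P A B =
      (∫⁻ a, klDiv (η a) (η ∘ₘ P.map A) ∂P.map A) / ENNReal.ofReal (Real.log 2) := by
  have := Measure.isProbabilityMeasure_map (μ := P) hA.aemeasurable
  have hB' : P.map B = η ∘ₘ P.map A := by
    rw [← Measure.snd_compProd, ← h, Measure.snd_map_prodMk hA]
  rw [mutualInfo, h, hB', ← Measure.compProd_const, klDiv_compProd_right]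
  rfl

/-- If `A` has conditional law `κ` given `C`, and `B` is the output of the channel `η` for the input
`(C, A)`, then `I(A;B|C)` is the average divergence of the conditional laws of `B` given `(C, A)`
from those given `C`. -/
theorem condMutualInfo_eq_lintegral [StandardBorelSpace α] [Nonempty α] [StandardBorelSpace β]
    [Nonempty β] {P : Measure Ω} [IsProbabilityMeasure P] {A : Ω → α} {B : Ω → β} {C : Ω → γ}
    (hA : Measurable A) (hB : Measurable B) (hC : Measurable C)
    (κ : Kernel γ α) [IsMarkovKernel κ] (η : Kernel (γ × α) β) [IsMarkovKernel η]
    (h1 : P.map (fun ω => (C ω, A ω)) = P.map C ⊗ₘ κ)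
    (h2 : P.map (fun ω => ((C ω, A ω), B ω)) = P.map (fun ω => (C ω, A ω)) ⊗ₘ η) :
    condMutualInfo P A B C =
      (∫⁻ p, klDiv (η p) ((κ ⊗ₖ η).snd p.1) ∂P.map (fun ω => (C ω, A ω))) /
        ENNReal.ofReal (Real.log 2) := by
  have := Measure.isProbabilityMeasure_map (μ := P) hC.aemeasurable
  have hA' : condDistrib A C P =ᵐ[P.map C] κ :=
    condDistrib_ae_eq_of_measure_eq_compProd C hA.aemeasurable h1
  have hjoint : P.map (fun ω => (C ω, (A ω, B ω))) = P.map C ⊗ₘ (κ ⊗ₖ η) := by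
    rw [← Measure.compProd_assoc', ← h1, ← h2,
      Measure.map_map MeasurableEquiv.prodAssoc.measurable (by fun_prop)]
    rfl
  have hB' : condDistrib B C P =ᵐ[P.map C] (κ ⊗ₖ η).snd := by
    refine condDistrib_ae_eq_of_measure_eq_compProd C hB.aemeasurable ?_
    rw [Kernel.snd_eq, Measure.compProd_map measurable_snd, ← hjoint,
      Measure.map_map (by fun_prop) (by fun_prop)]
    rfl
  -- Regrouped as `(C, A)` followed by `B`, the reference measure has the same `(C, A)`-marginal as
  -- the joint law, so only the kernels producing `B` remain to be compared.
  have hprod : P.map C ⊗ₘ (condDistrib A C P ×ₖ condDistrib B C P) =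
      ((P.map C ⊗ₘ κ) ⊗ₘ ((κ ⊗ₖ η).snd.comap Prod.fst measurable_fst)).map
        MeasurableEquiv.prodAssoc := by
    rw [Measure.compProd_assoc']
    refine Measure.compProd_congr ?_
    filter_upwards [hA', hB'] with c h h'
    rw [Kernel.prod_apply, h, h']
    ext s hs
    rw [Measure.prod_apply hs, Kernel.compProd_apply hs]
    rfl
  rw [condMutualInfo, hprod, hjoint, ← Measure.compProd_assoc', klDiv_map_measurableEquiv,
    klDiv_compProd_right, h1]
  rfl

end SingleLetter

/-! ### Splitting a vector into its coordinates in `S` and outside `S`. -/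

section Product

variable {ι : Type*} [DecidableEq ι] {X : ι → Type*}

theorem measurable_finset_piecewise [∀ j, MeasurableSpace (X j)] (S : Finset ι) :
    Measurable fun z : (∀ j, X j) × (∀ j, X j) => S.piecewise z.1 z.2 := by
  refine measurable_pi_iff.2 fun j => ?_
  by_cases h : j ∈ S
  · simp only [Finset.piecewise, h, if_true]
    fun_prop
  · simp only [Finset.piecewise, h, if_false]
    fun_prop

variable [Fintype ι]

/-- The vector with the given entries in `Sᶜ` and in `S`. -/
def glue (S : Finset ι) (c : ∀ j : ↥Sᶜ, X j) (a : ∀ j : ↥S, X j) : ∀ j, X j := fun j =>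
  if h : j ∈ S then a ⟨j, h⟩ else c ⟨j, Finset.mem_compl.2 h⟩

theorem measurable_glue [∀ j, MeasurableSpace (X j)] (S : Finset ι) :
    Measurable fun z : (∀ j : ↥Sᶜ, X j) × (∀ j : ↥S, X j) => glue S z.1 z.2 := by
  refine measurable_pi_iff.2 fun j => ?_
  by_cases h : j ∈ S
  · simp only [glue, h, dif_pos]
    fun_prop
  · simp only [glue, h]
    exact (measurable_pi_apply _).comp measurable_fst

@[simp]
theorem glue_restrict (S : Finset ι) (x z : ∀ j, X j) :
    glue S (Sᶜ.restrict x) (S.restrict z) = S.piecewise z x := by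
  ext j
  by_cases h : j ∈ S <;> simp [glue, h]

theorem map_restrict_compl_restrict_pi [∀ j, MeasurableSpace (X j)] (S : Finset ι) (μ : ∀ j, Measure (X j))
    [∀ j, IsProbabilityMeasure (μ j)] :
    (Measure.pi μ).map (fun x => (Sᶜ.restrict x, S.restrict x)) =
      ((Measure.pi μ).map Sᶜ.restrict).prod ((Measure.pi μ).map S.restrict) := by
  have h : iIndepFun (fun j (x : ∀ j, X j) => x j) (Measure.pi μ) :=
    iIndepFun_pi (X := fun _ x => x) fun _ => aemeasurable_id
  have h2 := h.indepFun_finset Sᶜ S disjoint_compl_left fun j => measurable_pi_apply j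
  exact (indepFun_iff_map_prod_eq_prod_map_map (Finset.measurable_restrict _).aemeasurable
    (Finset.measurable_restrict _).aemeasurable).1 h2

end Product

/-! ### The information quantities of the outer region for the law of `(U_0, X_[k], Y)`. -/

section Outer

open InformationTheory

variable {k : ℕ} {X : Fin k → Type*} {Y : Type*} [∀ j, MeasurableSpace (X j)] [MeasurableSpace Y]

/-- The law of `(U_0, X_[k])`. -/
noncomputable def inputLaw {m : ℕ} (q : ProbabilityMeasure (Fin m))
    (p : Fin m → ∀ j, ProbabilityMeasure (X j)) : Measure (Fin m × ∀ j, X j) :=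
  (q : Measure (Fin m)) ⊗ₘ inputKernel p

instance {m : ℕ} (q : ProbabilityMeasure (Fin m)) (p : Fin m → ∀ j, ProbabilityMeasure (X j)) :
    IsProbabilityMeasure (inputLaw q p) := by
  unfold inputLaw
  infer_instance

/-- The output law when the inputs in `S` are independent with laws `p j` and the others are
given by `x`. -/
noncomputable def outputLaw (W : Kernel (∀ j, X j) Y) (S : Finset (Fin k))
    (p : ∀ j, ProbabilityMeasure (X j)) (x : ∀ j, X j) : Measure Y :=
  W ∘ₘ (Measure.pi fun j => (p j : Measure (X j))).map fun z => S.piecewise z x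

instance (W : Kernel (∀ j, X j) Y) [IsMarkovKernel W] (S : Finset (Fin k))
    (p : ∀ j, ProbabilityMeasure (X j)) (x : ∀ j, X j) :
    IsProbabilityMeasure (outputLaw W S p x) := by
  have : Measurable fun z => S.piecewise z x :=
    (measurable_finset_piecewise S).comp measurable_prodMk_right
  have := Measure.isProbabilityMeasure_map
    (μ := Measure.pi fun j => (p j : Measure (X j))) this.aemeasurable
  unfold outputLaw
  infer_instance

theorem outputLaw_congr (W : Kernel (∀ j, X j) Y) {S : Finset (Fin k)}
    (p : ∀ j, ProbabilityMeasure (X j)) {x x' : ∀ j, X j} (h : ∀ j, j ∉ S → x j = x' j) :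
    outputLaw W S p x = outputLaw W S p x' := by
  have : ∀ z : ∀ j, X j, S.piecewise z x = S.piecewise z x' := fun z => by
    ext j
    by_cases hj : j ∈ S <;> simp [hj, h]
  simp [outputLaw, this]

variable {m : ℕ} (q : ProbabilityMeasure (Fin m)) (p : Fin m → ∀ j, ProbabilityMeasure (X j))
  (W : Kernel (∀ j, X j) Y) [IsMarkovKernel W]

theorem jointLaw_map_fst : (jointLaw q p W).map Prod.fst = inputLaw q p :=
  Measure.fst_compProd _ _

theorem lintegral_jointLaw_fst {F : Fin m × (∀ j, X j) → ℝ≥0∞} (hF : Measurable F) :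
    ∫⁻ ω, F ω.1 ∂jointLaw q p W = ∫⁻ ω, F ω ∂inputLaw q p := by
  rw [← jointLaw_map_fst q p W, lintegral_map hF measurable_fst]

theorem mutualInfo_jointLaw [StandardBorelSpace Y] :
    mutualInfo (jointLaw q p W) (fun ω => ω.1.2) (fun ω => ω.2) =
      (∫⁻ x, klDiv (W x) (W ∘ₘ (inputLaw q p).map Prod.snd) ∂(inputLaw q p).map Prod.snd) /
        ENNReal.ofReal (Real.log 2) := by
  have hX : (jointLaw q p W).map (fun ω => ω.1.2) = (inputLaw q p).map Prod.snd := by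
    rw [← jointLaw_map_fst q p W, Measure.map_map measurable_snd measurable_fst]
    rfl
  rw [mutualInfo_eq_lintegral (P := jointLaw q p W) (A := fun ω => ω.1.2) (by fun_prop) W, hX]
  rw [hX]
  ext s hs
  rw [Measure.map_apply (by fun_prop) hs, jointLaw,
    Measure.compProd_apply ((show Measurable fun ω : (Fin m × ∀ j, X j) × Y => (ω.1.2, ω.2) by
      fun_prop) hs), Measure.compProd_apply hs,
    lintegral_map (Kernel.measurable_kernel_prodMk_left hs) measurable_snd]
  rfl

theorem condMutualInfo_jointLaw [∀ j, StandardBorelSpace (X j)] [∀ j, Nonempty (X j)]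
    [StandardBorelSpace Y] [Nonempty Y] (S : Finset (Fin k)) :
    condMutualInfo (jointLaw q p W) (fun ω => S.restrict ω.1.2) (fun ω => ω.2)
        (fun ω => (ω.1.1, (Sᶜ).restrict ω.1.2)) =
      (∫⁻ ω, klDiv (W ω.2) (outputLaw W S (p ω.1) ω.2) ∂inputLaw q p) /
        ENNReal.ofReal (Real.log 2) := by
  -- This kernel ignores the coordinates in `Sᶜ`; that it is the conditional law of `X_S` (shown in
  -- `e3`) is the conditional independence of the inputs given `U_0`.
  let κ : Kernel (Fin m × ∀ j : ↥Sᶜ, X j) (∀ j : ↥S, X j) :=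
    ((inputKernel p).map S.restrict).comap Prod.fst measurable_fst
  have : IsMarkovKernel ((inputKernel p).map S.restrict) :=
    Kernel.IsMarkovKernel.map _ (Finset.measurable_restrict S)
  have hκ : IsMarkovKernel κ := by
    infer_instance
  have hg : Measurable fun z : (Fin m × ∀ j : ↥Sᶜ, X j) × (∀ j : ↥S, X j) => glue S z.1.2 z.2 :=
    (measurable_glue S).comp ((measurable_snd.comp measurable_fst).prodMk measurable_snd)
  let η : Kernel ((Fin m × ∀ j : ↥Sᶜ, X j) × (∀ j : ↥S, X j)) Y := W.comap _ hg
  have hη : IsMarkovKernel η := by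
    infer_instance
  have hr := Finset.measurable_restrict (X := X) S
  have hr' := Finset.measurable_restrict (X := X) Sᶜ
  have hCA : Measurable fun ω : Fin m × (∀ j, X j) => ((ω.1, Sᶜ.restrict ω.2), S.restrict ω.2) := by
    exact (measurable_fst.prodMk (hr'.comp measurable_snd)).prodMk (hr.comp measurable_snd)
  have hC : Measurable fun ω : Fin m × (∀ j, X j) => (ω.1, Sᶜ.restrict ω.2) :=
    measurable_fst.prodMk (hr'.comp measurable_snd)
  have e1 : (jointLaw q p W).map (fun ω => ((ω.1.1, Sᶜ.restrict ω.1.2), S.restrict ω.1.2)) =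
      (inputLaw q p).map fun ω => ((ω.1, Sᶜ.restrict ω.2), S.restrict ω.2) := by
    rw [← jointLaw_map_fst q p W, Measure.map_map hCA measurable_fst]
    rfl
  have e2 : (jointLaw q p W).map (fun ω => (ω.1.1, Sᶜ.restrict ω.1.2)) =
      (inputLaw q p).map fun ω => (ω.1, Sᶜ.restrict ω.2) := by
    rw [← jointLaw_map_fst q p W, Measure.map_map hC measurable_fst]
    rfl
  have hi : ∀ u, inputKernel p u = Measure.pi fun j => (p u j : Measure (X j)) := fun u => rfl
  have e3 : (inputLaw q p).map (fun ω => ((ω.1, Sᶜ.restrict ω.2), S.restrict ω.2)) =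
      (inputLaw q p).map (fun ω => (ω.1, Sᶜ.restrict ω.2)) ⊗ₘ κ := by
    ext s hs
    rw [Measure.map_apply hCA hs, inputLaw, Measure.compProd_apply (hCA hs),
      Measure.compProd_apply hs, lintegral_map (Kernel.measurable_kernel_prodMk_left hs) hC,
      Measure.lintegral_compProd
        (f := fun ω => κ (ω.1, Sᶜ.restrict ω.2) (Prod.mk (ω.1, Sᶜ.restrict ω.2) ⁻¹' s))
        ((Kernel.measurable_kernel_prodMk_left hs).comp hC)]
    refine lintegral_congr fun u => ?_
    have hs' : MeasurableSet {z : (∀ j : ↥Sᶜ, X j) × (∀ j : ↥S, X j) | ((u, z.1), z.2) ∈ s} :=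
      (show Measurable fun z : (∀ j : ↥Sᶜ, X j) × (∀ j : ↥S, X j) => ((u, z.1), z.2) by
        fun_prop) hs
    have h := congrArg (fun ν => ν {z | ((u, z.1), z.2) ∈ s})
      (map_restrict_compl_restrict_pi S fun j => (p u j : Measure (X j)))
    have := Measure.isProbabilityMeasure_map
      (μ := Measure.pi fun j => (p u j : Measure (X j))) hr.aemeasurable
    rw [Measure.map_apply (hr'.prodMk hr) hs', Measure.prod_apply hs',
      lintegral_map (measurable_measure_prodMk_left hs') hr'] at h
    rw [hi]
    refine Eq.trans h (lintegral_congr fun x => ?_)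
    simp only [κ, Kernel.comap_apply, Kernel.map_apply _ hr, hi]
    rfl
  rw [condMutualInfo_eq_lintegral (P := jointLaw q p W) (A := fun ω => S.restrict ω.1.2)
    (B := fun ω => ω.2) (C := fun ω => (ω.1.1, (Sᶜ).restrict ω.1.2))
    (hr.comp (measurable_snd.comp measurable_fst)) measurable_snd (hC.comp measurable_fst) κ η, e1]
  · congr 1
    rw [lintegral_map (f := fun p => klDiv (η p) ((κ ⊗ₖ η).snd p.1))
      (measurable_klDiv η ((κ ⊗ₖ η).snd.comap Prod.fst measurable_fst)) hCA]
    refine lintegral_congr fun ω => ?_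
    congr 1
    · simp [η, Finset.piecewise_same]
    · ext s hs
      have hpw : Measurable fun z : ∀ j, X j => S.piecewise z ω.2 :=
        (measurable_finset_piecewise S).comp measurable_prodMk_right
      rw [Kernel.snd_apply' _ _ hs, Kernel.compProd_apply (measurable_snd hs), outputLaw,
        Measure.bind_apply hs W.aemeasurable, lintegral_map (W.measurable_coe hs) hpw]
      simp only [κ, Kernel.comap_apply, Kernel.map_apply _ hr, hi]
      rw [lintegral_map _ hr]
      · simp [η, Set.preimage_preimage]
      · exact (η.measurable_coe hs).comp measurable_prodMk_left
  · rw [e1, e2, e3]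
  · rw [e1]
    ext s hs
    have hCAB : Measurable fun ω : (Fin m × ∀ j, X j) × Y =>
        (((ω.1.1, Sᶜ.restrict ω.1.2), S.restrict ω.1.2), ω.2) :=
      (hCA.comp measurable_fst).prodMk measurable_snd
    rw [Measure.map_apply hCAB hs, jointLaw, Measure.compProd_apply (hCAB hs), Measure.compProd_apply hs,
      lintegral_map (Kernel.measurable_kernel_prodMk_left hs) hCA]
    refine lintegral_congr fun ω => ?_
    simp only [η, Kernel.comap_apply, glue_restrict, Finset.piecewise_same]
    rfl

end Outer

/-! ### Converse by change of measure. -/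

section Converse

open InformationTheory

variable {M K β : Type*} [Fintype M] [Fintype K] [MeasurableSpace β]

/-- For messages sharing a key the law `Q` is the same and the decoding sets are disjoint, so each
key contributes at most 1. -/
theorem sum_measureReal_decoder_le_card [DecidableEq K] (Q : M → Measure β)
    [∀ w, IsProbabilityMeasure (Q w)] (key : M → K)
    (hQ : ∀ w w', key w = key w' → Q w = Q w') {g : β → M}
    (hg : ∀ w, MeasurableSet {y | g y = w}) :
    ∑ w, (Q w).real {y | g y = w} ≤ Fintype.card K := by
  have h1 : ∀ κ : K, ∑ w with key w = κ, (Q w).real {y | g y = w} ≤ 1 := by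
    intro κ
    rcases (Finset.univ.filter fun w => key w = κ).eq_empty_or_nonempty with h | ⟨w₀, h⟩
    · simp [h]
    · rw [Finset.mem_filter_univ] at h
      calc ∑ w with key w = κ, (Q w).real {y | g y = w}
          = ∑ w with key w = κ, (Q w₀).real {y | g y = w} :=
            Finset.sum_congr rfl fun w hw => by
              rw [hQ w w₀ (by rw [(Finset.mem_filter_univ w).1 hw, h])]
        _ = (Q w₀).real (⋃ w ∈ Finset.univ.filter fun w => key w = κ, {y | g y = w}) := by
            rw [measureReal_biUnion_finset _ fun w _ => hg w]
            intro w _ w' _ hne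
            exact Set.disjoint_left.2 fun y (hy : g y = w) (hy' : g y = w') => hne (hy ▸ hy')
        _ ≤ 1 := measureReal_le_one
  rw [← Finset.sum_fiberwise Finset.univ key]
  exact (Finset.sum_le_sum fun κ _ => h1 κ).trans (by simp)

theorem ofReal_sum_le {ι : Type*} (s : Finset ι) (f : ι → ℝ) :
    ENNReal.ofReal (∑ i ∈ s, f i) ≤ ∑ i ∈ s, ENNReal.ofReal (f i) := by
  classical
  induction s using Finset.induction_on with
  | empty => simp
  | insert a s ha ih =>
    rw [Finset.sum_insert ha, Finset.sum_insert ha]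
    exact ENNReal.ofReal_add_le.trans (by gcongr)

/-- A converse bound: if `w` is decoded from an observation with law `P w`, and the auxiliary laws
`Q w` depend on `w` only through `key w`, then the divergences of `P w` from `Q w` are on average at
least the logarithm of the number of messages per key, up to the probability of error. -/
theorem decoder_le_sum_klDiv [Nonempty M] [Nonempty K] (P Q : M → Measure β)
    [∀ w, IsProbabilityMeasure (P w)] [∀ w, IsProbabilityMeasure (Q w)] (key : M → K)
    (hQ : ∀ w w', key w = key w' → Q w = Q w') {g : β → M}
    (hg : ∀ w, MeasurableSet {y | g y = w}) :
    ENNReal.ofReal (Real.log (Fintype.card M / Fintype.card K) *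
        ∑ w, (P w).real {y | g y = w} - Fintype.card M) ≤ ∑ w, klDiv (P w) (Q w) := by
  classical
  have hM : (0 : ℝ) < Fintype.card M := by exact_mod_cast Fintype.card_pos
  have hK : (0 : ℝ) < Fintype.card K := by exact_mod_cast Fintype.card_pos
  -- With this choice `exp a * |K| = |M|`, so the penalty is one nat per message on average.
  set a := Real.log (Fintype.card M / Fintype.card K) with ha
  refine le_trans ?_ (Finset.sum_le_sum fun w _ =>
    mul_measureReal_sub_exp_le_klDiv (P w) (Q w) (hg w) a)
  refine le_trans (ENNReal.ofReal_le_ofReal ?_) (ofReal_sum_le _ _)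
  rw [Finset.sum_sub_distrib, ← Finset.mul_sum, ← Finset.mul_sum, ha,
    Real.exp_log (div_pos hM hK)]
  have h := mul_le_mul_of_nonneg_left (sum_measureReal_decoder_le_card Q key hQ hg)
    (div_pos hM hK).le
  rw [div_mul_cancel₀ _ hK.ne'] at h
  linarith

end Converse

/-! ### Uniform laws on finite sets and their images. -/

section Empirical

variable {ι α : Type*} [MeasurableSpace α]

/-- The law of `f i` for `i` uniform on the finite set `s`. -/
noncomputable def empirical (s : Finset ι) (f : ι → α) : Measure α :=
  (s.card : ℝ≥0∞)⁻¹ • ∑ i ∈ s, Measure.dirac (f i)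

theorem empirical_apply (s : Finset ι) (f : ι → α) {A : Set α} (hA : MeasurableSet A) :
    empirical s f A = (s.card : ℝ≥0∞)⁻¹ * ∑ i ∈ s, A.indicator 1 (f i) := by
  simp [empirical, Measure.dirac_apply' _ hA]

theorem lintegral_empirical [MeasurableSingletonClass α] (s : Finset ι) (f : ι → α)
    (F : α → ℝ≥0∞) : ∫⁻ a, F a ∂empirical s f = (s.card : ℝ≥0∞)⁻¹ * ∑ i ∈ s, F (f i) := by
  rw [empirical, lintegral_smul_measure, lintegral_finsetSum_measure]
  simp

theorem isProbabilityMeasure_empirical {s : Finset ι} (hs : s.Nonempty) (f : ι → α) :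
    IsProbabilityMeasure (empirical s f) := by
  refine ⟨?_⟩
  rw [empirical_apply _ _ MeasurableSet.univ]
  simp only [Set.indicator_univ, Pi.one_apply, Finset.sum_const, nsmul_eq_mul, mul_one]
  exact ENNReal.inv_mul_cancel (by simpa using hs.ne_empty) (ENNReal.natCast_ne_top _)

theorem pi_empirical {κ : Type*} [Fintype κ] [DecidableEq κ] {ι α : κ → Type*}
    [∀ j, MeasurableSpace (α j)] (s : ∀ j, Finset (ι j)) (hs : ∀ j, (s j).Nonempty)
    (f : ∀ j, ι j → α j) :
    Measure.pi (fun j => empirical (s j) (f j)) =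
      empirical (Fintype.piFinset s) fun w j => f j (w j) := by
  have := fun j => isProbabilityMeasure_empirical (hs j) (f j)
  refine Measure.pi_eq fun A hA => ?_
  rw [empirical_apply _ _ (MeasurableSet.univ_pi hA)]
  simp_rw [empirical_apply _ _ (hA _)]
  rw [Finset.prod_mul_distrib, Finset.prod_univ_sum, Fintype.card_piFinset]
  congr 1
  · rw [Nat.cast_prod, ENNReal.prod_inv_distrib]
    intro i _ j _ _
    exact Or.inr (ENNReal.natCast_ne_top _)
  · refine Finset.sum_congr rfl fun w _ => ?_
    by_cases h : ∀ j, f j (w j) ∈ A j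
    · rw [Set.indicator_of_mem (by simpa using h)]
      simp [h]
    · rw [Set.indicator_of_notMem (by simpa using h)]
      push Not at h
      obtain ⟨j, hj⟩ := h
      rw [Finset.prod_eq_zero (Finset.mem_univ j)]
      simp [hj]

/-- `empirical` as a probability measure, with an arbitrary value if `s` is empty. -/
noncomputable def empiricalProb [Nonempty α] (s : Finset ι) (f : ι → α) : ProbabilityMeasure α :=
  open Classical in
  if h : s.Nonempty then ⟨empirical s f, isProbabilityMeasure_empirical h f⟩
  else ⟨Measure.dirac (Classical.arbitrary α), inferInstance⟩

theorem coe_empiricalProb [Nonempty α] {s : Finset ι} (h : s.Nonempty) (f : ι → α) :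
    (empiricalProb s f : Measure α) = empirical s f := by
  simp [empiricalProb, h]

/-- Each `F j` occurs once for every element of its fiber, with the inverse fiber size as weight.
This is the tower property used to condition on the transcript. -/
theorem sum_fiber_average {ι κ : Type*} [Fintype ι] [DecidableEq κ] (σ : ι → κ) (F : ι → ℝ≥0∞) :
    ∑ i, ((Finset.univ.filter fun j => σ j = σ i).card : ℝ≥0∞)⁻¹ * ∑ j with σ j = σ i, F j =
      ∑ i, F i := by
  simp_rw [Finset.mul_sum, Finset.sum_filter]
  rw [Finset.sum_comm]
  refine Finset.sum_congr rfl fun j _ => ?_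
  have : ∀ i, (if σ j = σ i then
      ((Finset.univ.filter fun j => σ j = σ i).card : ℝ≥0∞)⁻¹ * F j else 0) =
      if σ i = σ j then ((Finset.univ.filter fun i => σ i = σ j).card : ℝ≥0∞)⁻¹ * F j else 0 := by
    intro i
    by_cases h : σ j = σ i
    · simp [h]
    · simp [h, Ne.symm h]
  simp_rw [this]
  rw [← Finset.sum_filter, Finset.sum_const, nsmul_eq_mul, ← mul_assoc, ENNReal.mul_inv_cancel,
    one_mul]
  · have : j ∈ Finset.univ.filter fun i => σ i = σ j := by simp
    exact_mod_cast Finset.card_ne_zero_of_mem this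
  · exact ENNReal.natCast_ne_top _

end Empirical

/-! ### Transcripts of the cooperation protocol. -/

namespace Code

variable {k : ℕ} {X : Fin k → Type*} {Y : Type*} [MeasurableSpace Y]
variable {b : ∀ j, X j → ℝ≥0} {Cin Cout B R : Fin k → ℝ≥0} {n L : ℕ}

/-- The symbols sent to the CF. -/
abbrev Transcript (c : Code Y b Cin Cout B R n L) : Type := ∀ j ℓ, Fin (c.sizeU j ℓ)

/-- The message vectors. -/
abbrev Messages (_ : Code Y b Cin Cout B R n L) : Type := ∀ j, Fin (numMessages n (R j))

/-- What the CF sends to encoder `j` in round `ℓ` when it receives the symbols `τ`. -/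
def reply (c : Code Y b Cin Cout B R n L) (τ : c.Transcript) (ℓ : Fin L) (j : Fin k) :
    Fin (c.sizeV j ℓ) :=
  c.ψ j ℓ fun i ℓ' => τ i ℓ'

/-- The symbols sent to the CF when the message vector is `w`. -/
def sent (c : Code Y b Cin Cout B R n L) (w : c.Messages) : c.Transcript := fun j ℓ =>
  c.φ j ℓ (w j) fun ℓ' => c.received w ℓ' j

/-- Encoder `j` with message `v` sends the symbols `τ j` if the CF replies as for `τ`. -/
def Compatible (c : Code Y b Cin Cout B R n L) (τ : c.Transcript) (j : Fin k)
    (v : Fin (numMessages n (R j))) : Prop :=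
  ∀ ℓ, τ j ℓ = c.φ j ℓ v fun ℓ' => c.reply τ ℓ' j

theorem received_eq_reply (c : Code Y b Cin Cout B R n L) (w : c.Messages) (ℓ : Fin L)
    (j : Fin k) : c.received w ℓ j = c.reply (c.sent w) ℓ j := by
  rw [received]
  rfl

theorem compatible_sent (c : Code Y b Cin Cout B R n L) (w : c.Messages) (j : Fin k) :
    c.Compatible (c.sent w) j (w j) := by
  intro ℓ
  simp only [sent, received_eq_reply]

/-- Induction on the round: a symbol is determined by the message and the earlier replies, which
depend only on symbols of earlier rounds. It yields both the product structure of transcript classes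
and the fact that a key determines the transcript. -/
theorem transcript_eq (c : Code Y b Cin Cout B R n L) {τ τ' : c.Transcript}
    (h : ∀ j, τ j = τ' j ∨ ∃ v, c.Compatible τ j v ∧ c.Compatible τ' j v) : τ = τ' := by
  suffices ∀ ℓ : ℕ, ∀ hℓ : ℓ < L, ∀ j, τ j ⟨ℓ, hℓ⟩ = τ' j ⟨ℓ, hℓ⟩ by
    ext j ℓ : 2
    exact this ℓ ℓ.2 j
  intro ℓ
  induction ℓ using Nat.strong_induction_on with
  | _ ℓ ih =>
    intro hℓ j
    rcases h j with h | ⟨v, h, h'⟩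
    · rw [h]
    · rw [h, h']
      congr 1
      ext ℓ' : 1
      simp only [reply]
      congr 1
      ext i ℓ'' : 2
      exact ih ℓ'' (lt_of_le_of_lt (show (ℓ'' : Fin L).val ≤ (ℓ' : Fin L).val from ℓ''.2) ℓ'.2) _ i

/-- The condition on the right is imposed on each message separately, so the messages with a given
transcript form a product set. -/
theorem sent_eq_iff (c : Code Y b Cin Cout B R n L) (w : c.Messages) (τ : c.Transcript) :
    c.sent w = τ ↔ ∀ j, c.Compatible τ j (w j) := by
  constructor
  · rintro rfl
    exact c.compatible_sent w
  · exact fun h => c.transcript_eq fun j => Or.inr ⟨w j, c.compatible_sent w j, h j⟩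

/-- The symbol that encoder `j` with message `v` transmits at time `t` when the symbols sent to the
CF are `τ`. -/
def symbol (c : Code Y b Cin Cout B R n L) (τ : c.Transcript) (t : Fin n) (j : Fin k)
    (v : Fin (numMessages n (R j))) : X j :=
  c.f j v (fun ℓ => c.reply τ ℓ j) t

theorem channelInput_eq_symbol (c : Code Y b Cin Cout B R n L) (w : c.Messages) (t : Fin n)
    (j : Fin k) : c.channelInput w t j = c.symbol (c.sent w) t j (w j) := by
  simp only [channelInput, symbol, received_eq_reply]

/-- The symbols sent to the CF by the encoders in `S`, and the messages of the other encoders. -/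
abbrev Key (c : Code Y b Cin Cout B R n L) (S : Finset (Fin k)) : Type :=
  (∀ j : ↥S, ∀ ℓ, Fin (c.sizeU j ℓ)) × ∀ j : ↥Sᶜ, Fin (numMessages n (R j))

/-- The symbols sent to the CF by the encoders in `S`, and the messages of the other encoders. -/
def key (c : Code Y b Cin Cout B R n L) (S : Finset (Fin k)) (w : c.Messages) : c.Key S :=
  (S.restrict (c.sent w), Sᶜ.restrict w)

theorem apply_eq_of_key_eq (c : Code Y b Cin Cout B R n L) {S : Finset (Fin k)} {w w' : c.Messages}
    (h : c.key S w = c.key S w') {j : Fin k} (hj : j ∉ S) : w j = w' j :=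
  congrFun (congrArg Prod.snd h) ⟨j, Finset.mem_compl.2 hj⟩

theorem sent_eq_of_key_eq (c : Code Y b Cin Cout B R n L) {S : Finset (Fin k)} {w w' : c.Messages}
    (h : c.key S w = c.key S w') : c.sent w = c.sent w' := by
  refine c.transcript_eq fun j => ?_
  by_cases hj : j ∈ S
  · exact Or.inl (congrFun (congrArg Prod.fst h) ⟨j, hj⟩)
  · refine Or.inr ⟨w j, c.compatible_sent w j, ?_⟩
    rw [c.apply_eq_of_key_eq h hj]
    exact c.compatible_sent w' j

theorem numMessages_pos (n : ℕ) (r : ℝ≥0) : 0 < numMessages n r := by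
  rw [numMessages, Nat.floor_pos]
  exact Real.one_le_rpow one_le_two (by positivity)

instance (n : ℕ) (r : ℝ≥0) : NeZero (numMessages n r) := ⟨(numMessages_pos n r).ne'⟩

/-- Rounding down costs at most one bit, since `2 ^ (n r) < N + 1 ≤ 2 N` for the integer part `N`.
-/
theorem logb_numMessages (n : ℕ) (r : ℝ≥0) : n * (r : ℝ) - 1 ≤ Real.logb 2 (numMessages n r) := by
  have h1 : (1 : ℝ) ≤ numMessages n r := by exact_mod_cast numMessages_pos n r
  have h2 := Nat.lt_floor_add_one ((2 : ℝ) ^ ((n : ℝ) * (r : ℝ)))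
  rw [Real.le_logb_iff_rpow_le one_lt_two (by linarith), Real.rpow_sub two_pos, Real.rpow_one]
  change _ < (numMessages n r : ℝ) + 1 at h2
  linarith

/-! ### The law of `(U_0, X_[k])` induced by a code. -/

section Law

variable (c : Code Y b Cin Cout B R n L)

/-- An enumeration of the values of `U_0`: a time and the symbols sent to the CF. -/
noncomputable def timeTranscript : Fin n × c.Transcript ≃ Fin (Fintype.card (Fin n × c.Transcript)) :=
  Fintype.equivFin _

/-- The value of `U_0`, for a time and a message vector. -/
noncomputable def auxVar (i : Fin n × c.Messages) : Fin (Fintype.card (Fin n × c.Transcript)) :=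
  c.timeTranscript (i.1, c.sent i.2)

instance : Nonempty c.Transcript :=
  ⟨fun j ℓ => ⟨0, c.sizeU_pos j ℓ⟩⟩

instance [Nonempty (Fin n)] : Nonempty (Fin (Fintype.card (Fin n × c.Transcript))) :=
  c.timeTranscript.nonempty_congr.1 inferInstance

/-- The law of `U_0`. -/
noncomputable def auxLaw [Nonempty (Fin n)] : ProbabilityMeasure (Fin (Fintype.card (Fin n × c.Transcript))) :=
  empiricalProb Finset.univ c.auxVar

variable [∀ j, MeasurableSpace (X j)] [∀ j, Nonempty (X j)]

open Classical in
/-- The conditional laws of the channel inputs given `U_0`. -/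
noncomputable def condInputLaw (u : Fin (Fintype.card (Fin n × c.Transcript))) (j : Fin k) :
    ProbabilityMeasure (X j) :=
  empiricalProb (Finset.univ.filter (c.Compatible (c.timeTranscript.symm u).2 j))
    (c.symbol (c.timeTranscript.symm u).2 (c.timeTranscript.symm u).1 j)

-- Conditional independence given `U_0`: a product of uniform laws is uniform on the product of the
-- compatible sets, which is the transcript class. Those sets are nonempty since they contain the
-- components of `w`, so the arbitrary value in `empiricalProb` never enters.
open Classical in
theorem pi_condInputLaw (t : Fin n) (w : c.Messages) :
    Measure.pi (fun j => (c.condInputLaw (c.auxVar (t, w)) j : Measure (X j))) =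
      empirical (Finset.univ.filter fun w' => c.sent w' = c.sent w) (fun w' => c.channelInput w' t)
      := by
  have h : ∀ j, (Finset.univ.filter (c.Compatible (c.sent w) j)).Nonempty := fun j =>
    ⟨w j, by simpa using c.compatible_sent w j⟩
  have h2 : ∀ j, (c.condInputLaw (c.auxVar (t, w)) j : Measure (X j)) =
      empirical (Finset.univ.filter (c.Compatible (c.sent w) j)) (c.symbol (c.sent w) t j) := by
    intro j
    rw [condInputLaw, auxVar, Equiv.symm_apply_apply, coe_empiricalProb (h j)]
  simp_rw [h2]
  rw [pi_empirical _ h]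
  have h3 : Fintype.piFinset (fun j => Finset.univ.filter (c.Compatible (c.sent w) j)) =
      Finset.univ.filter fun w' => c.sent w' = c.sent w := by
    ext w'
    simp [sent_eq_iff]
  rw [h3, empirical, empirical]
  congr 1
  refine Finset.sum_congr rfl fun w' hw' => ?_
  congr 1
  ext j
  rw [channelInput_eq_symbol, (Finset.mem_filter_univ w').1 hw']

/-- The factorized law is the true law of `U_0` and the channel input for uniform time and messages,
so averages under it are averages over the code. -/
theorem inputLaw_eq_empirical [Nonempty (Fin n)] :
    inputLaw c.auxLaw c.condInputLaw =
      empirical Finset.univ fun i : Fin n × c.Messages =>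
        (c.auxVar i, c.channelInput i.2 i.1) := by
  classical
  ext A hA
  rw [inputLaw, Measure.compProd_apply hA, auxLaw, coe_empiricalProb Finset.univ_nonempty,
    lintegral_empirical, empirical_apply _ _ hA]
  congr 1
  rw [Fintype.sum_prod_type, Fintype.sum_prod_type]
  refine Finset.sum_congr rfl fun t _ => ?_
  rw [← sum_fiber_average c.sent fun w => A.indicator 1 (c.auxVar (t, w), c.channelInput w t)]
  refine Finset.sum_congr rfl fun w _ => ?_
  change Measure.pi (fun j => (c.condInputLaw (c.auxVar (t, w)) j : Measure (X j))) _ = _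
  rw [pi_condInputLaw, empirical_apply _ _ (measurable_prodMk_left hA)]
  congr 1
  refine Finset.sum_congr rfl fun w' hw' => ?_
  rw [auxVar, auxVar, (Finset.mem_filter_univ w').1 hw']
  rfl

end Law

end Code

/-! ### Rate bounds at finite blocklength. -/

open InformationTheory

theorem ofReal_le_inv_mul_div_log_two {n N : ℕ} (hn : 0 < n) (hN : 0 < N) {y z : ℝ} {A : ℝ≥0∞}
    (hA : ENNReal.ofReal (N * y) ≤ A) (hz : z * n * Real.log 2 ≤ y) :
    ENNReal.ofReal z ≤ (((n * N : ℕ) : ℝ≥0∞)⁻¹ * A) / ENNReal.ofReal (Real.log 2) := by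
  have h2 : 0 < Real.log 2 := Real.log_pos one_lt_two
  have hn' : (0 : ℝ) < n := by exact_mod_cast hn
  have hN' : (0 : ℝ) < N := by exact_mod_cast hN
  rw [ENNReal.le_div_iff_mul_le (Or.inl (by simpa using h2)) (Or.inl ENNReal.ofReal_ne_top),
    mul_comm _ A, ← div_eq_mul_inv,
    ENNReal.le_div_iff_mul_le (Or.inl (by exact_mod_cast (Nat.mul_pos hn hN).ne'))
      (Or.inl (ENNReal.natCast_ne_top _)),
    ← ENNReal.ofReal_mul' h2.le, ← ENNReal.ofReal_natCast, ← ENNReal.ofReal_mul' (by positivity)]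
  refine le_trans (ENNReal.ofReal_le_ofReal ?_) hA
  push_cast
  nlinarith

namespace Code

variable {k : ℕ} {X : Fin k → Type*} {Y : Type*} [MeasurableSpace Y]
variable {b : ∀ j, X j → ℝ≥0} {Cin Cout B R : Fin k → ℝ≥0} {n L : ℕ}

/-- The messages outside `S` cancel in the quotient. The messages in `S` lose at most one bit each
to rounding, and their transcripts are limited by the link capacities. -/
theorem logb_card_div_card_key (c : Code Y b Cin Cout B R n L) (S : Finset (Fin k)) :
    n * ∑ j ∈ S, (R j : ℝ) - S.card - n * ∑ j ∈ S, (Cin j : ℝ) ≤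
      Real.logb 2 (Fintype.card c.Messages / Fintype.card (c.Key S)) := by
  have hM : ∀ j, (numMessages n (R j) : ℝ) ≠ 0 := fun j => by
    exact_mod_cast (numMessages_pos n (R j)).ne'
  have hU : ∀ j ℓ, (c.sizeU j ℓ : ℝ) ≠ 0 := fun j ℓ => by exact_mod_cast (c.sizeU_pos j ℓ).ne'
  have e1 : Real.logb 2 (Fintype.card c.Messages) =
      ∑ j ∈ S, Real.logb 2 (numMessages n (R j)) + ∑ j ∈ Sᶜ, Real.logb 2 (numMessages n (R j)) := by
    rw [Finset.sum_add_sum_compl, Fintype.card_pi, Nat.cast_prod, Real.logb_prod]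
    · simp
    · simpa using hM
  have e2 : Real.logb 2 (Fintype.card (c.Key S)) =
      ∑ j ∈ S, ∑ ℓ, Real.logb 2 (c.sizeU j ℓ) + ∑ j ∈ Sᶜ, Real.logb 2 (numMessages n (R j)) := by
    rw [Fintype.card_prod, Fintype.card_pi, Fintype.card_pi, Nat.cast_mul, Nat.cast_prod,
      Nat.cast_prod]
    simp only [Fintype.card_pi, Fintype.card_fin, Nat.cast_prod]
    rw [Real.logb_mul, Real.logb_prod, Real.logb_prod,
      ← Finset.sum_coe_sort S, ← Finset.sum_coe_sort Sᶜ]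
    · congr 1
      refine Finset.sum_congr rfl fun j _ => ?_
      rw [Real.logb_prod _ _ fun ℓ _ => hU j ℓ]
    · exact fun j _ => hM j
    · exact fun j _ => Finset.prod_ne_zero_iff.2 fun ℓ _ => hU j ℓ
    · exact Finset.prod_ne_zero_iff.2 fun j _ => Finset.prod_ne_zero_iff.2 fun ℓ _ => hU j ℓ
    · exact Finset.prod_ne_zero_iff.2 fun j _ => hM j
  have hk : (Fintype.card (c.Key S) : ℝ) ≠ 0 := by
    have : Nonempty (c.Key S) := ⟨c.key S fun _ => 0⟩
    exact_mod_cast Fintype.card_ne_zero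
  rw [Real.logb_div (by exact_mod_cast Fintype.card_ne_zero) hk, e1, e2]
  have h1 : ∑ j ∈ S, (n * (R j : ℝ) - 1) ≤ ∑ j ∈ S, Real.logb 2 (numMessages n (R j)) :=
    Finset.sum_le_sum fun j _ => logb_numMessages n (R j)
  have h2 : ∑ j ∈ S, ∑ ℓ, Real.logb 2 (c.sizeU j ℓ) ≤ ∑ j ∈ S, n * (Cin j : ℝ) :=
    Finset.sum_le_sum fun j _ => c.link_in j
  rw [Finset.sum_sub_distrib, ← Finset.mul_sum] at h1
  rw [← Finset.mul_sum] at h2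
  simp only [Finset.sum_const, nsmul_eq_mul, mul_one] at h1
  linarith

theorem measurableSet_decoded (c : Code Y b Cin Cout B R n L) (w : c.Messages) :
    MeasurableSet {y | c.g y = w} :=
  c.measurable_g (measurableSet_singleton w)

variable [∀ j, MeasurableSpace (X j)]

theorem sum_measureReal_decoded (W : Kernel (∀ j, X j) Y) [IsMarkovKernel W]
    (c : Code Y b Cin Cout B R n L) :
    ∑ w : c.Messages, (Measure.pi fun t => W (c.channelInput w t)).real {y | c.g y = w} =
      Fintype.card c.Messages * (1 - (c.errorProb W).toReal) := by
  have h : ∀ w : c.Messages,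
      (Measure.pi fun t => W (c.channelInput w t)).real {y | c.g y = w} =
        1 - (Measure.pi (fun t => W (c.channelInput w t)) {y | c.g y ≠ w}).toReal := by
    intro w
    have := probReal_compl_eq_one_sub (μ := Measure.pi fun t => W (c.channelInput w t))
      (c.measurableSet_decoded w)
    change _ = 1 - (Measure.pi fun t => W (c.channelInput w t)).real {y | c.g y = w}ᶜ
    rw [this]
    ring
  have hN : (Fintype.card c.Messages : ℝ) ≠ 0 := by exact_mod_cast Fintype.card_ne_zero
  simp_rw [h]
  rw [Finset.sum_sub_distrib, errorProb, ENNReal.toReal_div, ENNReal.toReal_sum]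
  · rw [mul_sub, ENNReal.toReal_natCast, mul_div_cancel₀ _ hN]
    simp
  · exact fun w _ => measure_ne_top _ _

theorem errorProb_toReal_le_one (W : Kernel (∀ j, X j) Y) [IsMarkovKernel W]
    (c : Code Y b Cin Cout B R n L) : (c.errorProb W).toReal ≤ 1 := by
  have h := c.sum_measureReal_decoded W
  have hN : (0 : ℝ) < Fintype.card c.Messages := by exact_mod_cast Fintype.card_pos
  have h2 : 0 ≤ Fintype.card c.Messages * (1 - (c.errorProb W).toReal) :=
    h ▸ Finset.sum_nonneg fun w _ => measureReal_nonneg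
  have := nonneg_of_mul_nonneg_right h2 hN
  linarith

theorem le_sum_klDiv {K : Type*} [Fintype K] [Nonempty K] (W : Kernel (∀ j, X j) Y)
    [IsMarkovKernel W] (c : Code Y b Cin Cout B R n L) (key : c.Messages → K)
    (Q : Fin n → c.Messages → Measure Y) [∀ t w, IsProbabilityMeasure (Q t w)]
    (hQ : ∀ t w w', key w = key w' → Q t w = Q t w') :
    ENNReal.ofReal (Fintype.card c.Messages * ((1 - (c.errorProb W).toReal) *
        Real.log (Fintype.card c.Messages / Fintype.card K) - 1)) ≤
      ∑ i : Fin n × c.Messages, klDiv (W (c.channelInput i.2 i.1)) (Q i.1 i.2) := by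
  have h := decoder_le_sum_klDiv (fun w => Measure.pi fun t => W (c.channelInput w t))
    (fun w => Measure.pi fun t => Q t w) key
    (fun w w' hw => congrArg Measure.pi (funext fun t => hQ t w w' hw)) c.measurableSet_decoded
  rw [sum_measureReal_decoded] at h
  simp_rw [klDiv_pi] at h
  rw [Fintype.sum_prod_type_right]
  refine le_trans (le_of_eq ?_) h
  congr 1
  ring

variable [∀ j, StandardBorelSpace (X j)] [∀ j, Nonempty (X j)]

theorem lintegral_inputLaw [Nonempty (Fin n)] (c : Code Y b Cin Cout B R n L)
    (F : Fin (Fintype.card (Fin n × c.Transcript)) × (∀ j, X j) → ℝ≥0∞) :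
    ∫⁻ ω, F ω ∂inputLaw c.auxLaw c.condInputLaw =
      ((n * Fintype.card c.Messages : ℕ) : ℝ≥0∞)⁻¹ *
        ∑ i : Fin n × c.Messages, F (c.auxVar i, c.channelInput i.2 i.1) := by
  rw [inputLaw_eq_empirical, lintegral_empirical, Finset.card_univ, Fintype.card_prod,
    Fintype.card_fin]

theorem lintegral_cost_le [Nonempty (Fin n)] (hb : ∀ j, Measurable (b j))
    (W : Kernel (∀ j, X j) Y) [IsMarkovKernel W] (c : Code Y b Cin Cout B R n L) (j : Fin k) :
    ∫⁻ ω, (b j (ω.1.2 j) : ℝ≥0∞) ∂jointLaw c.auxLaw c.condInputLaw W ≤ (B j : ℝ≥0∞) := by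
  have hb' := hb j
  rw [lintegral_jointLaw_fst c.auxLaw c.condInputLaw W (F := fun ω => (b j (ω.2 j) : ℝ≥0∞))
    (by fun_prop), lintegral_inputLaw, mul_comm, ← div_eq_mul_inv]
  refine ENNReal.div_le_of_le_mul ?_
  rw [Fintype.sum_prod_type_right]
  have : ∀ w : c.Messages, ∑ t, (b j (c.channelInput w t j) : ℝ≥0∞) ≤ n * B j := fun w => by
    exact_mod_cast c.cost_le j (w j) fun ℓ => c.received w ℓ j
  refine (Finset.sum_le_sum fun w _ => this w).trans (le_of_eq ?_)
  rw [Finset.sum_const, Finset.card_univ, nsmul_eq_mul]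
  push_cast
  ring

theorem le_condMutualInfo [Nonempty (Fin n)] [StandardBorelSpace Y] [Nonempty Y]
    (W : Kernel (∀ j, X j) Y) [IsMarkovKernel W] (c : Code Y b Cin Cout B R n L)
    (S : Finset (Fin k)) :
    ENNReal.ofReal ((1 - (c.errorProb W).toReal) * ∑ j ∈ S, (R j : ℝ) - ∑ j ∈ S, (Cin j : ℝ) -
        (k + 2) / n) ≤
      condMutualInfo (jointLaw c.auxLaw c.condInputLaw W) (fun ω => S.restrict ω.1.2) (fun ω => ω.2)
        (fun ω => (ω.1.1, (Sᶜ).restrict ω.1.2)) := by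
  have hn : 0 < n := Fin.pos_iff_nonempty.2 inferInstance
  have : Nonempty (c.Key S) := ⟨c.key S fun _ => 0⟩
  rw [condMutualInfo_jointLaw, lintegral_inputLaw]
  refine ofReal_le_inv_mul_div_log_two hn Fintype.card_pos (c.le_sum_klDiv W (c.key S)
    (fun t w => outputLaw W S (c.condInputLaw (c.auxVar (t, w))) (c.channelInput w t)) ?_) ?_
  -- The key determines the transcript, hence `U_0` at each time, and the inputs outside `S`;
  -- `outputLaw` sees nothing else.
  · intro t w w' h
    rw [auxVar, auxVar, c.sent_eq_of_key_eq h]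
    refine outputLaw_congr W _ fun j hj => ?_
    rw [channelInput_eq_symbol, channelInput_eq_symbol, c.sent_eq_of_key_eq h,
      c.apply_eq_of_key_eq h hj]
  · have h1 := c.logb_card_div_card_key S
    rw [Real.logb, le_div_iff₀ (Real.log_pos one_lt_two)] at h1
    have h2 := mul_le_mul_of_nonneg_left h1 (sub_nonneg.2 (c.errorProb_toReal_le_one W))
    refine le_trans ?_ (sub_le_sub_right h2 1)
    have hS : (S.card : ℝ) ≤ k := by
      exact_mod_cast (Finset.card_le_univ S).trans_eq (Fintype.card_fin k)
    have hn' : (n : ℝ) ≠ 0 := by exact_mod_cast hn.ne'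
    have hε : 0 ≤ (c.errorProb W).toReal := ENNReal.toReal_nonneg
    have hC : 0 ≤ n * ∑ j ∈ S, (Cin j : ℝ) := by positivity
    -- In `(k + 2) / n`, `k` covers the rounding of the message numbers and `2` bits cover the
    -- penalty of one nat.
    have hl : 1 ≤ 2 * Real.log 2 := by linarith [Real.log_two_gt_d9]
    have e : ((1 - (c.errorProb W).toReal) * ∑ j ∈ S, (R j : ℝ) - ∑ j ∈ S, (Cin j : ℝ) -
        (k + 2) / n) * n = (1 - (c.errorProb W).toReal) * (n * ∑ j ∈ S, (R j : ℝ)) -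
          n * ∑ j ∈ S, (Cin j : ℝ) - k - 2 := by
      field_simp
      ring
    rw [e]
    have h3 : 0 ≤ ((c.errorProb W).toReal * (S.card + n * ∑ j ∈ S, (Cin j : ℝ)) +
      (k - S.card)) * Real.log 2 := mul_nonneg (add_nonneg (by positivity) (by linarith))
        (Real.log_pos one_lt_two).le
    nlinarith

theorem le_mutualInfo [Nonempty (Fin n)] [StandardBorelSpace Y]
    (W : Kernel (∀ j, X j) Y) [IsMarkovKernel W] (c : Code Y b Cin Cout B R n L) :
    ENNReal.ofReal ((1 - (c.errorProb W).toReal) * ∑ j, (R j : ℝ) - (k + 2) / n) ≤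
      mutualInfo (jointLaw c.auxLaw c.condInputLaw W) (fun ω => ω.1.2) (fun ω => ω.2) := by
  have hn : 0 < n := Fin.pos_iff_nonempty.2 inferInstance
  have := Measure.isProbabilityMeasure_map (μ := inputLaw c.auxLaw c.condInputLaw)
    measurable_snd.aemeasurable
  set ν := W ∘ₘ (inputLaw c.auxLaw c.condInputLaw).map Prod.snd with hν
  rw [mutualInfo_jointLaw, ← hν,
    lintegral_map (f := fun x => klDiv (W x) ν) (measurable_klDiv W (Kernel.const _ ν))
      measurable_snd, lintegral_inputLaw]
  -- A one-point key: the reference law is the same for all messages and all times.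
  refine ofReal_le_inv_mul_div_log_two hn Fintype.card_pos
    (c.le_sum_klDiv W (fun _ => ()) (fun _ _ => ν) fun _ _ _ _ => rfl) ?_
  have hcard : Real.logb 2 (Fintype.card c.Messages / (Fintype.card Unit : ℕ)) =
      ∑ j, Real.logb 2 (numMessages n (R j)) := by
    rw [Fintype.card_unit, Nat.cast_one, div_one, Fintype.card_pi, Nat.cast_prod, Real.logb_prod]
    · simp
    · intro j _
      simpa using (numMessages_pos n (R j)).ne'
  have h1 : n * ∑ j, (R j : ℝ) - k ≤
      Real.logb 2 (Fintype.card c.Messages / (Fintype.card Unit : ℕ)) := by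
    rw [hcard]
    refine le_trans (le_of_eq ?_) (Finset.sum_le_sum fun j _ => logb_numMessages n (R j))
    rw [Finset.sum_sub_distrib, ← Finset.mul_sum]
    simp
  rw [Real.logb, le_div_iff₀ (Real.log_pos one_lt_two)] at h1
  have h2 := mul_le_mul_of_nonneg_left h1 (sub_nonneg.2 (c.errorProb_toReal_le_one W))
  refine le_trans ?_ (sub_le_sub_right h2 1)
  have hn' : (n : ℝ) ≠ 0 := by exact_mod_cast hn.ne'
  have hl : 1 ≤ 2 * Real.log 2 := by linarith [Real.log_two_gt_d9]
  have e : ((1 - (c.errorProb W).toReal) * ∑ j, (R j : ℝ) - (k + 2) / n) * n =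
      (1 - (c.errorProb W).toReal) * (n * ∑ j, (R j : ℝ)) - k - 2 := by
    field_simp
    ring
  rw [e]
  have h3 : 0 ≤ (c.errorProb W).toReal * k * Real.log 2 :=
    mul_nonneg (mul_nonneg ENNReal.toReal_nonneg (by positivity)) (Real.log_pos one_lt_two).le
  nlinarith

end Code

/-! ### Passage to the limit in the blocklength. -/

section Limit

variable {k : ℕ} {X : Fin k → Type*} {Y : Type*} [∀ j, MeasurableSpace (X j)] [MeasurableSpace Y]

theorem exists_pos_le_of_ne_zero {ι : Type*} [Finite ι] (R : ι → ℝ≥0) :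
    ∃ r : ℝ, 0 < r ∧ ∀ j, R j ≠ 0 → r ≤ R j := by
  have h : ∀ᶠ r : ℝ in 𝓝[>] 0, ∀ j, R j ≠ 0 → r ≤ R j := by
    refine eventually_all.2 fun j => ?_
    by_cases hj : R j = 0
    · simp [hj]
    · have : (0 : ℝ) < R j := NNReal.coe_pos.2 (pos_iff_ne_zero.2 hj)
      filter_upwards [Ioc_mem_nhdsGT this] with r hr _ using hr.2
  obtain ⟨r, hr, hr0⟩ := (h.and self_mem_nhdsWithin).exists
  exact ⟨r, hr0, hr⟩

/-- Turns the additive loss `a` into a multiplicative one: a nonzero sum of rates is at least `r`,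
so `a ≤ (a / r) * ∑ R j`. Hence one multiple of `R` meets the constraints for all `S` at once and
stays nonnegative. -/
theorem scaled_sum_le {ι : Type*} (R : ι → ℝ≥0) (S : Finset ι) {r : ℝ} (hr : 0 < r)
    (hR : ∀ j, R j ≠ 0 → r ≤ R j) {ε a : ℝ} (ha : 0 ≤ a) :
    (((∑ j ∈ S, (1 - (ε + a / r)).toNNReal * R j : ℝ≥0)) : ℝ≥0∞) ≤
      ENNReal.ofReal ((1 - ε) * ∑ j ∈ S, (R j : ℝ) - a) := by
  rw [← Finset.mul_sum]
  by_cases h : ∑ j ∈ S, R j = 0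
  · simp [h]
  · obtain ⟨j, hj, hj0⟩ : ∃ j ∈ S, R j ≠ 0 := by
      by_contra! h'
      exact h (Finset.sum_eq_zero h')
    have h1 : r ≤ ∑ j ∈ S, (R j : ℝ) :=
      (hR j hj0).trans (Finset.single_le_sum (f := fun j => (R j : ℝ))
        (fun i _ => NNReal.coe_nonneg _) hj)
    have h2 : (((1 - (ε + a / r)).toNNReal * ∑ j ∈ S, R j : ℝ≥0) : ℝ≥0∞) =
        ENNReal.ofReal ((1 - (ε + a / r)) * ∑ j ∈ S, (R j : ℝ)) := by
      rw [ENNReal.ofReal_mul' (Finset.sum_nonneg fun i _ => NNReal.coe_nonneg _), ENNReal.coe_mul]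
      congr 1
      rw [← NNReal.coe_sum, ENNReal.ofReal_coe_nnreal]
    rw [h2]
    refine ENNReal.ofReal_le_ofReal ?_
    have h3 : a / r * r ≤ a / r * ∑ j ∈ S, (R j : ℝ) :=
      mul_le_mul_of_nonneg_left h1 (div_nonneg ha hr.le)
    rw [div_mul_cancel₀ _ hr.ne'] at h3
    linarith

variable [∀ j, StandardBorelSpace (X j)] [∀ j, Nonempty (X j)] [StandardBorelSpace Y] [Nonempty Y]

theorem Achievable.mem_closure_outerRegion {W : Kernel (∀ j, X j) Y} [IsMarkovKernel W]
    {b : ∀ j, X j → ℝ≥0} (hb : ∀ j, Measurable (b j)) {Cin Cout B R : Fin k → ℝ≥0}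
    (h : Achievable W b Cin Cout B R) : R ∈ closure (outerRegion W b Cin B) := by
  obtain ⟨L, c, hc⟩ := h
  obtain ⟨r, hr, hR⟩ := exists_pos_le_of_ne_zero R
  have hε : Tendsto (fun n => ((c n).errorProb W).toReal) atTop (𝓝 0) := by
    exact (ENNReal.tendsto_toReal ENNReal.zero_ne_top).comp hc
  have hk : Tendsto (fun n : ℕ => ((k : ℝ) + 2) / n) atTop (𝓝 0) :=
    tendsto_const_div_atTop_nhds_zero_nat _
  have hδ : Tendsto (fun n : ℕ => (1 - (((c n).errorProb W).toReal + ((k : ℝ) + 2) / n / r)).toNNReal)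
      atTop (𝓝 1) := by
    have h1 := (continuous_real_toNNReal.tendsto 1).comp
      (by simpa using (tendsto_const_nhds (x := (1 : ℝ))).sub (hε.add (hk.div_const r)))
    simpa [Function.comp_def] using h1
  refine mem_closure_of_tendsto (f := fun n j =>
    (1 - (((c n).errorProb W).toReal + ((k : ℝ) + 2) / n / r)).toNNReal * R j) (b := atTop)
    (tendsto_pi_nhds.2 fun j => by simpa using hδ.mul_const (R j)) ?_
  filter_upwards [eventually_gt_atTop 0] with n hn
  have : Nonempty (Fin n) := Fin.pos_iff_nonempty.1 hn
  have ha : (0 : ℝ) ≤ ((k : ℝ) + 2) / n := by positivity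
  refine ⟨_, (c n).auxLaw, (c n).condInputLaw, (c n).lintegral_cost_le hb W, fun S _ => ?_, ?_⟩
  · refine (scaled_sum_le R S hr hR ha).trans ?_
    refine le_trans ?_ (add_le_add_left ((c n).le_condMutualInfo W S) _)
    have hC : ((∑ j ∈ S, Cin j : ℝ≥0) : ℝ≥0∞) = ENNReal.ofReal (∑ j ∈ S, (Cin j : ℝ)) := by
      rw [← NNReal.coe_sum, ENNReal.ofReal_coe_nnreal]
    rw [hC]
    refine le_trans (ENNReal.ofReal_le_ofReal ?_) ENNReal.ofReal_add_le
    linarith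
  · exact (scaled_sum_le R Finset.univ hr hR ha).trans ((c n).le_mutualInfo W)

end Limit

/-! ### Compactness of convex hulls and continuity at vanishing weights. -/

theorem isCompact_convexHull {E : Type*} [AddCommGroup E] [Module ℝ E] [TopologicalSpace E]
    [ContinuousAdd E] [ContinuousSMul ℝ E] [FiniteDimensional ℝ E] {s : Set E}
    (hs : IsCompact s) : IsCompact (convexHull ℝ s) := by
  have h : convexHull ℝ s = ⋃ n ∈ Finset.range (Module.finrank ℝ E + 2),
      (fun z : (Fin n → ℝ) × (Fin n → E) => ∑ i, z.1 i • z.2 i) ''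
        (stdSimplex ℝ (Fin n) ×ˢ Set.univ.pi fun _ => s) := by
    refine Set.Subset.antisymm ?_ ?_
    -- Carathéodory: affinely independent points suffice, so at most `finrank + 1` of them.
    · rw [convexHull_eq_union]
      refine Set.iUnion_subset fun t => Set.iUnion_subset fun hts => Set.iUnion_subset fun hai => ?_
      intro x hx
      obtain ⟨w, hw0, hw1, hx⟩ := Finset.mem_convexHull'.1 hx
      have hcard : t.card < Module.finrank ℝ E + 2 := by
        have := hai.card_le_finrank_succ
        rw [Fintype.card_coe] at this
        have h2 := Submodule.finrank_le (vectorSpan ℝ (Set.range ((↑) : t → E)))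
        omega
      refine Set.mem_biUnion (Finset.mem_coe.2 (Finset.mem_range.2 hcard)) ?_
      refine ⟨(fun i => w (t.equivFin.symm i), fun i => t.equivFin.symm i), ⟨⟨fun i => ?_, ?_⟩,
        fun i _ => ?_⟩, ?_⟩
      · exact hw0 _ (t.equivFin.symm i).2
      · change ∑ i, w (t.equivFin.symm i) = 1
        rw [Equiv.sum_comp t.equivFin.symm fun y : t => w y, Finset.sum_coe_sort t w, hw1]
      · exact hts (t.equivFin.symm i).2
      · change ∑ i, w (t.equivFin.symm i) • (t.equivFin.symm i : E) = x
        rw [Equiv.sum_comp t.equivFin.symm fun y : t => w y • (y : E),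
          Finset.sum_coe_sort t fun y => w y • y, hx]
    · refine Set.iUnion₂_subset fun n _ => ?_
      rintro _ ⟨⟨w, z⟩, ⟨hw, hz⟩, rfl⟩
      exact (convex_convexHull ℝ s).sum_mem (fun i _ => hw.1 i) hw.2
        fun i _ => subset_convexHull ℝ s (hz i trivial)
  rw [h]
  refine (Finset.range _).isCompact_biUnion fun n _ => IsCompact.image ?_ (by fun_prop)
  exact (isCompact_stdSimplex ℝ (Fin n)).prod (isCompact_univ_pi fun _ => hs)

/-- Where `h` vanishes so does `a`, and `|a log h| ≤ |h log h|` tends to 0. -/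
theorem continuousOn_mul_log {T : Type*} [TopologicalSpace T] {s : Set T} {a h : T → ℝ}
    (ha : ContinuousOn a s) (hh : ContinuousOn h s) (h0 : ∀ p ∈ s, 0 ≤ a p)
    (h1 : ∀ p ∈ s, a p ≤ h p) : ContinuousOn (fun p => a p * Real.log (h p)) s := by
  intro p hp
  rcases ((h0 p hp).trans (h1 p hp)).eq_or_lt with hz | hz
  · have h2 : ContinuousWithinAt (fun p => |h p * Real.log (h p)|) s p :=
      (Real.continuous_mul_log.abs.continuousAt.comp_continuousWithinAt (hh p hp))
    have ha0 : a p = 0 := le_antisymm ((h1 p hp).trans_eq hz.symm) (h0 p hp)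
    rw [ContinuousWithinAt, ha0, zero_mul]
    rw [ContinuousWithinAt, ← hz, zero_mul, abs_zero] at h2
    refine squeeze_zero_norm' ?_ h2
    filter_upwards [self_mem_nhdsWithin] with x hx
    rw [Real.norm_eq_abs, abs_mul, abs_mul]
    gcongr
    · exact h0 x hx
    · exact h1 x hx
  · exact (ha p hp).mul ((hh p hp).log hz.ne')

/-! ### Divergence from a finite mixture as a function of the weights. -/

section Mixture

open InformationTheory

variable {J β : Type*} [Fintype J] [MeasurableSpace β]

/-- The mixture of the measures `V j` with weights `p j`. -/
noncomputable def mixture (V : J → Measure β) (p : J → ℝ) : Measure β :=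
  ∑ j, ENNReal.ofReal (p j) • V j

instance (V : J → Measure β) [∀ j, IsFiniteMeasure (V j)] (p : J → ℝ) :
    IsFiniteMeasure (mixture V p) := by
  have : ∀ j, IsFiniteMeasure (ENNReal.ofReal (p j) • V j) := fun j =>
    Measure.smul_finite _ ENNReal.ofReal_ne_top
  unfold mixture
  infer_instance

theorem smul_le_mixture (V : J → Measure β) (p : J → ℝ) (i : J) :
    ENNReal.ofReal (p i) • V i ≤ mixture V p :=
  Finset.single_le_sum (f := fun j => ENNReal.ofReal (p j) • V j) (fun _ _ => Measure.zero_le _)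
    (Finset.mem_univ i)

theorem absolutelyContinuous_mixture (V : J → Measure β) {p : J → ℝ} {i : J} (hi : 0 < p i) :
    V i ≪ mixture V p :=
  (Measure.absolutelyContinuous_smul (ENNReal.ofReal_pos.2 hi).ne').trans
    (smul_le_mixture V p i).absolutelyContinuous

/-- The density of `μ` is at most `c⁻¹`, and `klFun` is bounded on `[0, c⁻¹]`. -/
theorem klDiv_ne_top_of_smul_le {μ ν : Measure β} [IsFiniteMeasure μ] [IsFiniteMeasure ν] {c : ℝ}
    (hc : 0 < c) (h : ENNReal.ofReal c • μ ≤ ν) : klDiv μ ν ≠ ∞ := by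
  have hac : μ ≪ ν :=
    (Measure.absolutelyContinuous_smul (ENNReal.ofReal_pos.2 hc).ne').trans h.absolutelyContinuous
  refine klDiv_ne_top hac ((integrable_klFun_rnDeriv_iff hac).1 ?_)
  obtain ⟨M, hM⟩ := (isCompact_Icc (a := (0 : ℝ)) (b := c⁻¹)).exists_bound_of_continuousOn
    continuous_klFun.continuousOn
  refine Integrable.of_bound (Measurable.aestronglyMeasurable (by fun_prop)) M ?_
  have h1 := Measure.rnDeriv_le_one_of_le h
  have h2 := Measure.rnDeriv_smul_left_of_ne_top μ ν (ENNReal.ofReal_ne_top (r := c))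
  filter_upwards [h1, h2] with y h1 h2
  refine hM _ ⟨ENNReal.toReal_nonneg, ?_⟩
  rw [h2, Pi.smul_apply, smul_eq_mul] at h1
  have h3 := ENNReal.toReal_mono ENNReal.one_ne_top h1
  simp only [ENNReal.toReal_mul, ENNReal.toReal_ofReal hc.le,
    ENNReal.toReal_one] at h3
  rwa [inv_eq_one_div, le_div_iff₀' hc]

/-- `p i` times the divergence of `V i` from the mixture, as an integral of a function of the
densities `g` with respect to a common reference measure. -/
theorem mul_toReal_klDiv_mixture (V : J → Measure β) [∀ j, IsFiniteMeasure (V j)] {p : J → ℝ}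
    (hp : ∀ j, 0 ≤ p j) (i : J) {μ : Measure β} [IsFiniteMeasure μ] (hV : ∀ j, V j ≤ μ) :
    p i * (klDiv (V i) (mixture V p)).toReal =
      ∫ y, (p i * ((V i).rnDeriv μ y).toReal * Real.log ((V i).rnDeriv μ y).toReal -
        p i * ((V i).rnDeriv μ y).toReal * Real.log (∑ j, p j * ((V j).rnDeriv μ y).toReal) +
        (p i * ∑ j, p j * ((V j).rnDeriv μ y).toReal - p i * ((V i).rnDeriv μ y).toReal)) ∂μ := by
  rcases (hp i).eq_or_lt with hi | hi
  · simp [← hi]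
  have hac := absolutelyContinuous_mixture V hi
  have hdens : mixture V p =
      μ.withDensity fun y => ∑ j, ENNReal.ofReal (p j) * (V j).rnDeriv μ y := by
    ext s hs
    rw [withDensity_apply _ hs, lintegral_finsetSum _ fun j _ => by fun_prop, mixture,
      Measure.finsetSum_apply]
    refine Finset.sum_congr rfl fun j _ => ?_
    rw [lintegral_const_mul _ (by fun_prop),
      Measure.setLIntegral_rnDeriv (hV j).absolutelyContinuous]
    rfl
  have hmix : mixture V p ≪ μ := hdens ▸ withDensity_absolutelyContinuous _ _
  have hd : (mixture V p).rnDeriv μ =ᵐ[μ] fun y => ∑ j, ENNReal.ofReal (p j) * (V j).rnDeriv μ y :=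
    hdens ▸ Measure.rnDeriv_withDensity μ (by fun_prop)
  rw [toReal_klDiv_eq_integral_klFun hac, ← integral_rnDeriv_smul hmix, ← integral_const_mul]
  refine integral_congr_ae ?_
  have hle : ∀ᵐ y ∂μ, ∀ j, (V j).rnDeriv μ y ≤ 1 :=
    ae_all_iff.2 fun j => Measure.rnDeriv_le_one_of_le (hV j)
  filter_upwards [hd, Measure.rnDeriv_mul_rnDeriv (κ := μ) hac, hle] with y hd hr hle
  have hh : ((mixture V p).rnDeriv μ y).toReal = ∑ j, p j * ((V j).rnDeriv μ y).toReal := by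
    rw [hd, ENNReal.toReal_sum]
    · simp [ENNReal.toReal_ofReal (hp _)]
    · exact fun j _ => ENNReal.mul_ne_top ENNReal.ofReal_ne_top
        (ne_top_of_le_ne_top ENNReal.one_ne_top (hle j))
  have hg : ((V i).rnDeriv (mixture V p) y).toReal * ∑ j, p j * ((V j).rnDeriv μ y).toReal =
      ((V i).rnDeriv μ y).toReal := by
    rw [← hh, ← hr, Pi.mul_apply, ENNReal.toReal_mul]
  rw [hh, smul_eq_mul, klFun_apply, ← hg]
  set h := ∑ j, p j * ((V j).rnDeriv μ y).toReal
  set r := ((V i).rnDeriv (mixture V p) y).toReal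
  by_cases h0 : h = 0
  · simp [h0]
  by_cases r0 : r = 0
  · simp [r0]
  rw [Real.log_mul r0 h0]
  ring

/-- Dominated convergence against `∑ j, V j`, a reference measure independent of the weights. The
factor `p i` is needed because absolute continuity may fail where it vanishes. -/
theorem continuousOn_mul_toReal_klDiv_mixture (V : J → Measure β) [∀ j, IsFiniteMeasure (V j)]
    (i : J) : ContinuousOn (fun p : J → ℝ => p i * (klDiv (V i) (mixture V p)).toReal)
      (stdSimplex ℝ J) := by
  set μ : Measure β := ∑ j, V j with hμ
  have hV : ∀ j, V j ≤ μ := fun j =>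
    Finset.single_le_sum (f := fun j => V j) (fun _ _ => Measure.zero_le _) (Finset.mem_univ j)
  have hle : ∀ᵐ y ∂μ, ∀ j, ((V j).rnDeriv μ y).toReal ≤ 1 := by
    refine ae_all_iff.2 fun j => ?_
    filter_upwards [Measure.rnDeriv_le_one_of_le (hV j)] with y hy
    simpa using ENNReal.toReal_mono ENNReal.one_ne_top hy
  have hmul : ∀ p ∈ stdSimplex ℝ J, ∀ y,
      p i * ((V i).rnDeriv μ y).toReal ≤ ∑ j, p j * ((V j).rnDeriv μ y).toReal := fun p hp y =>
    Finset.single_le_sum (f := fun j => p j * ((V j).rnDeriv μ y).toReal)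
      (fun j _ => mul_nonneg (hp.1 j) ENNReal.toReal_nonneg) (Finset.mem_univ i)
  have hlog : ∀ x : ℝ, 0 ≤ x → x ≤ 1 → |x * Real.log x| ≤ 1 := fun x hx hx1 => by
    rcases hx.eq_or_lt with rfl | hx
    · simp
    · rw [mul_comm]
      exact (Real.abs_log_mul_self_lt x hx hx1).le
  refine ContinuousOn.congr ?_ fun p hp => mul_toReal_klDiv_mixture V hp.1 i hV
  -- All densities lie in `[0, 1]`, so each of the four terms of the integrand is at most 1 in
  -- absolute value.
  refine continuousOn_of_dominated (bound := fun _ => 4) ?_ ?_ (integrable_const _) ?_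
  · intro p _
    exact Measurable.aestronglyMeasurable (by fun_prop)
  · intro p hp
    filter_upwards [hle] with y hy
    have hpi : p i ≤ 1 := hp.2 ▸ Finset.single_le_sum (fun j _ => hp.1 j) (Finset.mem_univ i)
    have hh0 : 0 ≤ ∑ j, p j * ((V j).rnDeriv μ y).toReal :=
      Finset.sum_nonneg fun j _ => mul_nonneg (hp.1 j) ENNReal.toReal_nonneg
    have hh1 : ∑ j, p j * ((V j).rnDeriv μ y).toReal ≤ 1 :=
      (Finset.sum_le_sum fun j _ => mul_le_of_le_one_right (hp.1 j) (hy j)).trans_eq hp.2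
    have hg := hy i
    have hm := hmul p hp y
    have hg0 : 0 ≤ ((V i).rnDeriv μ y).toReal := ENNReal.toReal_nonneg
    generalize ((V i).rnDeriv μ y).toReal = g at *
    generalize ∑ j, p j * ((V j).rnDeriv μ y).toReal = h at *
    have hp0 := hp.1 i
    have a1 : |p i * g * Real.log g| ≤ 1 := by
      rw [mul_assoc, abs_mul, abs_of_nonneg hp0]
      exact mul_le_one₀ hpi (abs_nonneg _) (hlog g hg0 hg)
    have a2 : |p i * g * Real.log h| ≤ 1 := by
      refine le_trans ?_ (hlog h hh0 hh1)
      rw [abs_mul, abs_mul h, abs_of_nonneg (mul_nonneg hp0 hg0), abs_of_nonneg hh0]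
      gcongr
    have a3 : p i * h ≤ 1 := mul_le_one₀ hpi hh0 hh1
    have a4 : p i * g ≤ 1 := mul_le_one₀ hpi hg0 hg
    have a5 := mul_nonneg hp0 hh0
    have a6 := mul_nonneg hp0 hg0
    rw [Real.norm_eq_abs, abs_le]
    rw [abs_le] at a1 a2
    constructor <;> linarith
  · refine Eventually.of_forall fun y => ?_
    refine ContinuousOn.add (ContinuousOn.sub (by fun_prop) ?_) (by fun_prop)
    exact continuousOn_mul_log (by fun_prop) (by fun_prop)
      (fun p hp => mul_nonneg (hp.1 i) ENNReal.toReal_nonneg) fun p hp => hmul p hp y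

end Mixture

/-! ### Closedness of the outer region for finite input alphabets. -/

section FiniteInputs

open InformationTheory

theorem exists_probabilityMeasure_real_singleton {α : Type*} [Fintype α] [MeasurableSpace α]
    [MeasurableSingletonClass α] {v : α → ℝ} (hv : v ∈ stdSimplex ℝ α) :
    ∃ p : ProbabilityMeasure α, ∀ a, (p : Measure α).real {a} = v a := by
  refine ⟨⟨mixture Measure.dirac v, ⟨?_⟩⟩, fun a => ?_⟩
  · simp only [mixture, Measure.finsetSum_apply, Measure.smul_apply, measure_univ, smul_eq_mul,
      mul_one]
    rw [← ENNReal.ofReal_sum_of_nonneg fun a _ => hv.1 a, hv.2, ENNReal.ofReal_one]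
  · classical
    change (mixture Measure.dirac v).real {a} = v a
    simp [mixture, measureReal_def, Measure.finsetSum_apply, Set.indicator_apply,
      ENNReal.toReal_ofReal (hv.1 a)]

theorem real_singleton_mem_stdSimplex {α : Type*} [Fintype α] [MeasurableSpace α]
    [MeasurableSingletonClass α] (p : ProbabilityMeasure α) :
    (fun a => (p : Measure α).real {a}) ∈ stdSimplex ℝ α := by
  refine ⟨fun a => measureReal_nonneg, ?_⟩
  rw [sum_measureReal_singleton]
  simp

theorem coe_sum_le_ofReal_add_iff {ι : Type*} (S : Finset ι) (R C : ι → ℝ≥0) {a : ℝ} (ha : 0 ≤ a) :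
    ((∑ j ∈ S, R j : ℝ≥0) : ℝ≥0∞) ≤ ENNReal.ofReal a + ((∑ j ∈ S, C j : ℝ≥0) : ℝ≥0∞) ↔
      ∑ j ∈ S, (R j : ℝ) ≤ a + ∑ j ∈ S, (C j : ℝ) := by
  rw [ENNReal.ofReal, ← ENNReal.coe_add, ENNReal.coe_le_coe, ← NNReal.coe_le_coe]
  push_cast
  rw [Real.coe_toNNReal _ ha]

variable {k : ℕ} {X : Fin k → Type*} {Y : Type*}

/-- The weights of the product distribution. -/
def prodWeights (v : ∀ j, X j → ℝ) (x : ∀ j, X j) : ℝ := ∏ j, v j (x j)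

theorem prodWeights_mem_stdSimplex [∀ j, Fintype (X j)] {v : ∀ j, X j → ℝ}
    (hv : ∀ j, v j ∈ stdSimplex ℝ (X j)) : prodWeights v ∈ stdSimplex ℝ (∀ j, X j) := by
  refine ⟨fun x => Finset.prod_nonneg fun j _ => (hv j).1 _, ?_⟩
  have h := Finset.prod_univ_sum (fun j => (Finset.univ : Finset (X j))) fun j a => v j a
  rw [Fintype.piFinset_univ] at h
  simp only [prodWeights]
  rw [← h]
  exact Finset.prod_eq_one fun j _ => (hv j).2

variable [∀ j, MeasurableSpace (X j)] [MeasurableSpace Y]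

/-- The weights of a family of distributions. -/
def weights (p : ∀ j, ProbabilityMeasure (X j)) (j : Fin k) (a : X j) : ℝ :=
  (p j : Measure (X j)).real {a}

theorem pi_singleton_eq_ofReal_prodWeights (p : ∀ j, ProbabilityMeasure (X j)) (x : ∀ j, X j) :
    Measure.pi (fun j => (p j : Measure (X j))) {x} = ENNReal.ofReal (prodWeights (weights p) x) := by
  simp only [Measure.pi_singleton, prodWeights, weights]
  rw [ENNReal.ofReal_prod_of_nonneg fun j _ => measureReal_nonneg]
  refine Finset.prod_congr rfl fun j _ => ?_
  rw [ofReal_measureReal]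

variable [∀ j, Fintype (X j)]

/-- The average divergence of the output law from the one when the inputs in `S` are replaced by
independent ones. -/
noncomputable def averageDiv (W : Kernel (∀ j, X j) Y) (S : Finset (Fin k)) (P : (∀ j, X j) → ℝ) :
    ℝ :=
  ∑ x, P x * (klDiv (W x) (mixture (fun z => W (S.piecewise z x)) P)).toReal

theorem averageDiv_nonneg (W : Kernel (∀ j, X j) Y) (S : Finset (Fin k)) {P : (∀ j, X j) → ℝ}
    (hP : ∀ x, 0 ≤ P x) : 0 ≤ averageDiv W S P :=
  Finset.sum_nonneg fun x _ => mul_nonneg (hP x) ENNReal.toReal_nonneg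

theorem continuousOn_averageDiv (W : Kernel (∀ j, X j) Y) [IsMarkovKernel W]
    (S : Finset (Fin k)) : ContinuousOn (averageDiv W S) (stdSimplex ℝ (∀ j, X j)) := by
  refine continuousOn_finsetSum _ fun x _ => ?_
  have h := continuousOn_mul_toReal_klDiv_mixture (fun z => W (S.piecewise z x)) x
  rwa [Finset.piecewise_same] at h

theorem ofReal_averageDiv (W : Kernel (∀ j, X j) Y) [IsMarkovKernel W] (S : Finset (Fin k))
    {P : (∀ j, X j) → ℝ} (hP : ∀ x, 0 ≤ P x) :
    ENNReal.ofReal (averageDiv W S P) =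
      ∑ x, ENNReal.ofReal (P x) * klDiv (W x) (mixture (fun z => W (S.piecewise z x)) P) := by
  rw [averageDiv, ENNReal.ofReal_sum_of_nonneg fun x _ => mul_nonneg (hP x) ENNReal.toReal_nonneg]
  refine Finset.sum_congr rfl fun x _ => ?_
  rw [ENNReal.ofReal_mul (hP x)]
  rcases (hP x).eq_or_lt with h | h
  · simp [← h]
  · rw [ENNReal.ofReal_toReal]
    refine klDiv_ne_top_of_smul_le h ?_
    have := smul_le_mixture (fun z => W (S.piecewise z x)) P x
    rwa [Finset.piecewise_same] at this

/-- The weights of the law of the inputs, and the conditional mutual informations in bits, for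
independent inputs. -/
noncomputable def profile (W : Kernel (∀ j, X j) Y) (v : ∀ j, X j → ℝ) :
    ((∀ j, X j) → ℝ) × (Finset (Fin k) → ℝ) :=
  (prodWeights v, fun S => averageDiv W S (prodWeights v) / Real.log 2)

variable {m : ℕ} (q : ProbabilityMeasure (Fin m)) (p : Fin m → ∀ j, ProbabilityMeasure (X j))

/-- The average of the profiles over `U_0`. -/
noncomputable def meanProfile (W : Kernel (∀ j, X j) Y) :
    ((∀ j, X j) → ℝ) × (Finset (Fin k) → ℝ) :=
  ∑ u, (q : Measure (Fin m)).real {u} • profile W (weights (p u))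

theorem meanProfile_fst (W : Kernel (∀ j, X j) Y) (x : ∀ j, X j) :
    (meanProfile q p W).1 x =
      ∑ u, (q : Measure (Fin m)).real {u} * prodWeights (weights (p u)) x := by
  simp [meanProfile, profile, Prod.fst_sum, Finset.sum_apply]

theorem meanProfile_snd (W : Kernel (∀ j, X j) Y) (S : Finset (Fin k)) :
    (meanProfile q p W).2 S =
      (∑ u, (q : Measure (Fin m)).real {u} * averageDiv W S (prodWeights (weights (p u)))) /
        Real.log 2 := by
  simp [meanProfile, profile, Prod.snd_sum, Finset.sum_apply, Finset.sum_div, mul_div_assoc]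

/-- The convex hull of the profiles of independent inputs. -/
def profileHull (W : Kernel (∀ j, X j) Y) : Set (((∀ j, X j) → ℝ) × (Finset (Fin k) → ℝ)) :=
  convexHull ℝ (profile W '' Set.univ.pi fun j => stdSimplex ℝ (X j))

theorem isCompact_profileHull (W : Kernel (∀ j, X j) Y) [IsMarkovKernel W] : IsCompact (profileHull W) := by
  refine isCompact_convexHull (IsCompact.image_of_continuousOn
    (isCompact_univ_pi fun j => isCompact_stdSimplex ℝ (X j)) ?_)
  have h1 : Continuous (prodWeights : (∀ j, X j → ℝ) → (∀ j, X j) → ℝ) := by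
    unfold prodWeights
    fun_prop
  refine h1.continuousOn.prodMk (continuousOn_pi.2 fun S => ?_)
  exact ((continuousOn_averageDiv W S).comp h1.continuousOn
    fun v (hv : v ∈ Set.univ.pi fun j => stdSimplex ℝ (X j)) =>
      prodWeights_mem_stdSimplex fun j => hv j trivial).div_const _

theorem fst_mem_stdSimplex_of_mem_profileHull (W : Kernel (∀ j, X j) Y)
    {c : ((∀ j, X j) → ℝ) × (Finset (Fin k) → ℝ)}
    (hc : c ∈ profileHull W) : c.1 ∈ stdSimplex ℝ (∀ j, X j) := by
  have h : Convex ℝ (Prod.fst ⁻¹' stdSimplex ℝ (∀ j, X j) :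
      Set (((∀ j, X j) → ℝ) × (Finset (Fin k) → ℝ))) :=
    (convex_stdSimplex ℝ _).linear_preimage (LinearMap.fst ℝ _ _)
  refine convexHull_min ?_ h hc
  rintro _ ⟨v, hv, rfl⟩
  exact prodWeights_mem_stdSimplex fun j => hv j trivial

variable [∀ j, MeasurableSingletonClass (X j)]

theorem outputLaw_eq_mixture (W : Kernel (∀ j, X j) Y) (S : Finset (Fin k))
    (p : ∀ j, ProbabilityMeasure (X j)) (x : ∀ j, X j) :
    outputLaw W S p x =
      mixture (fun z => W (S.piecewise z x)) (prodWeights (weights p)) := by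
  ext s hs
  rw [outputLaw, Measure.bind_apply hs W.aemeasurable,
    lintegral_map (W.measurable_coe hs) (Measurable.of_discrete), lintegral_fintype, mixture,
    Measure.finsetSum_apply]
  refine Finset.sum_congr rfl fun z _ => ?_
  rw [pi_singleton_eq_ofReal_prodWeights, mul_comm]
  rfl

theorem lintegral_inputLaw_eq_sum (F : Fin m × (∀ j, X j) → ℝ≥0∞) :
    ∫⁻ ω, F ω ∂inputLaw q p = ∑ u, ENNReal.ofReal ((q : Measure (Fin m)).real {u}) *
      ∑ x, ENNReal.ofReal (prodWeights (weights (p u)) x) * F (u, x) := by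
  rw [inputLaw, Measure.lintegral_compProd Measurable.of_discrete, lintegral_fintype]
  refine Finset.sum_congr rfl fun u _ => ?_
  rw [ofReal_measureReal, mul_comm]
  congr 1
  change ∫⁻ x, F (u, x) ∂(Measure.pi fun j => (p u j : Measure (X j))) = _
  rw [lintegral_fintype]
  refine Finset.sum_congr rfl fun x _ => ?_
  rw [pi_singleton_eq_ofReal_prodWeights, mul_comm]

theorem weights_mem_stdSimplex (p : ∀ j, ProbabilityMeasure (X j)) (j : Fin k) :
    weights p j ∈ stdSimplex ℝ (X j) :=
  real_singleton_mem_stdSimplex (p j)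

theorem prodWeights_weights_nonneg (p : ∀ j, ProbabilityMeasure (X j)) (x : ∀ j, X j) :
    0 ≤ prodWeights (weights p) x :=
  (prodWeights_mem_stdSimplex (weights_mem_stdSimplex p)).1 x

theorem meanProfile_fst_nonneg (W : Kernel (∀ j, X j) Y) (x : ∀ j, X j) :
    0 ≤ (meanProfile q p W).1 x := by
  rw [meanProfile_fst]
  exact Finset.sum_nonneg fun u _ => mul_nonneg measureReal_nonneg (prodWeights_weights_nonneg _ x)

theorem meanProfile_snd_nonneg (W : Kernel (∀ j, X j) Y) (S : Finset (Fin k)) :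
    0 ≤ (meanProfile q p W).2 S := by
  rw [meanProfile_snd]
  exact div_nonneg (Finset.sum_nonneg fun u _ => mul_nonneg measureReal_nonneg
    (averageDiv_nonneg W S (prodWeights_weights_nonneg _))) (Real.log_pos one_lt_two).le

theorem lintegral_inputLaw_snd (W : Kernel (∀ j, X j) Y) (F : (∀ j, X j) → ℝ≥0∞) :
    ∫⁻ ω, F ω.2 ∂inputLaw q p = ∑ x, ENNReal.ofReal ((meanProfile q p W).1 x) * F x := by
  rw [lintegral_inputLaw_eq_sum q p fun ω => F ω.2]
  simp_rw [Finset.mul_sum, meanProfile_fst]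
  rw [Finset.sum_comm]
  refine Finset.sum_congr rfl fun x _ => ?_
  rw [ENNReal.ofReal_sum_of_nonneg fun u _ =>
    mul_nonneg measureReal_nonneg (prodWeights_weights_nonneg _ x), Finset.sum_mul]
  refine Finset.sum_congr rfl fun u _ => ?_
  rw [ENNReal.ofReal_mul measureReal_nonneg, mul_assoc]

variable (W : Kernel (∀ j, X j) Y) [IsMarkovKernel W]

theorem lintegral_cost_eq (b : ∀ j, X j → ℝ≥0) (j : Fin k) :
    ∫⁻ ω, (b j (ω.1.2 j) : ℝ≥0∞) ∂jointLaw q p W =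
      ENNReal.ofReal (∑ x, (meanProfile q p W).1 x * b j (x j)) := by
  rw [lintegral_jointLaw_fst q p W (F := fun ω => (b j (ω.2 j) : ℝ≥0∞)) Measurable.of_discrete,
    lintegral_inputLaw_snd q p W fun x => (b j (x j) : ℝ≥0∞), ENNReal.ofReal_sum_of_nonneg
      fun x _ => mul_nonneg (meanProfile_fst_nonneg q p W x) (NNReal.coe_nonneg _)]
  refine Finset.sum_congr rfl fun x _ => ?_
  rw [ENNReal.ofReal_mul (meanProfile_fst_nonneg q p W x), ENNReal.ofReal_coe_nnreal]

theorem mutualInfo_eq_ofReal [StandardBorelSpace Y] :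
    mutualInfo (jointLaw q p W) (fun ω => ω.1.2) (fun ω => ω.2) =
      ENNReal.ofReal (averageDiv W Finset.univ (meanProfile q p W).1 / Real.log 2) := by
  have h : W ∘ₘ (inputLaw q p).map Prod.snd =
      mixture (fun z => W z) (meanProfile q p W).1 := by
    ext s hs
    rw [Measure.bind_apply hs W.aemeasurable, lintegral_map (W.measurable_coe hs) measurable_snd,
      lintegral_inputLaw_snd q p W fun x => W x s, mixture, Measure.finsetSum_apply]
    rfl
  rw [mutualInfo_jointLaw, h, lintegral_map Measurable.of_discrete measurable_snd,
    lintegral_inputLaw_snd q p W fun x => klDiv (W x) (mixture (fun z => W z) (meanProfile q p W).1),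
    ENNReal.ofReal_div_of_pos (Real.log_pos one_lt_two),
    ofReal_averageDiv W _ (meanProfile_fst_nonneg q p W)]
  simp

variable [∀ j, StandardBorelSpace (X j)] [∀ j, Nonempty (X j)] [StandardBorelSpace Y] [Nonempty Y]

theorem condMutualInfo_eq_ofReal (S : Finset (Fin k)) :
    condMutualInfo (jointLaw q p W) (fun ω => S.restrict ω.1.2) (fun ω => ω.2)
        (fun ω => (ω.1.1, (Sᶜ).restrict ω.1.2)) = ENNReal.ofReal ((meanProfile q p W).2 S) := by
  rw [condMutualInfo_jointLaw, lintegral_inputLaw_eq_sum, meanProfile_snd,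
    ENNReal.ofReal_div_of_pos (Real.log_pos one_lt_two), ENNReal.ofReal_sum_of_nonneg
      fun u _ => mul_nonneg measureReal_nonneg
        (averageDiv_nonneg W S (prodWeights_weights_nonneg _))]
  congr 1
  refine Finset.sum_congr rfl fun u _ => ?_
  rw [ENNReal.ofReal_mul measureReal_nonneg, ofReal_averageDiv W S (prodWeights_weights_nonneg _)]
  simp only [outputLaw_eq_mixture]

/-- The constraints of the outer region, in terms of the mean profile. -/
def ProfileConstraints (b : ∀ j, X j → ℝ≥0) (Cin B R : Fin k → ℝ≥0)
    (c : ((∀ j, X j) → ℝ) × (Finset (Fin k) → ℝ)) : Prop :=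
  (∀ j, ∑ x, c.1 x * b j (x j) ≤ B j) ∧
    (∀ S : Finset (Fin k), S.Nonempty → ∑ j ∈ S, (R j : ℝ) ≤ c.2 S + ∑ j ∈ S, (Cin j : ℝ)) ∧
    ∑ j, (R j : ℝ) ≤ averageDiv W Finset.univ c.1 / Real.log 2

/-- Averaging over `U_0` is a convex combination of profiles. Costs and `I(X_[k]; Y)` depend only on
the marginal law of the inputs, the first component of the mean, and the conditional informations
are the second component. -/
theorem mem_outerRegion_iff {b : ∀ j, X j → ℝ≥0} {Cin B R : Fin k → ℝ≥0} :
    R ∈ outerRegion W b Cin B ↔ ∃ c ∈ profileHull W, ProfileConstraints W b Cin B R c := by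
  have key : ∀ (m : ℕ) (q : ProbabilityMeasure (Fin m)) (p : Fin m → ∀ j, ProbabilityMeasure (X j)),
      ProfileConstraints W b Cin B R (meanProfile q p W) ↔
        (∀ j, ∫⁻ ω, (b j (ω.1.2 j) : ℝ≥0∞) ∂(jointLaw q p W) ≤ (B j : ℝ≥0∞)) ∧
        (∀ S : Finset (Fin k), S.Nonempty →
          ((∑ j ∈ S, R j : ℝ≥0) : ℝ≥0∞) ≤
            condMutualInfo (jointLaw q p W) (fun ω => S.restrict ω.1.2) (fun ω => ω.2)
                (fun ω => (ω.1.1, (Sᶜ).restrict ω.1.2)) + ((∑ j ∈ S, Cin j : ℝ≥0) : ℝ≥0∞)) ∧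
        ((∑ j, R j : ℝ≥0) : ℝ≥0∞) ≤
          mutualInfo (jointLaw q p W) (fun ω => ω.1.2) (fun ω => ω.2) := by
    intro m q p
    simp only [condMutualInfo_eq_ofReal, mutualInfo_eq_ofReal, lintegral_cost_eq]
    refine and_congr (forall_congr' fun j => ?_) (and_congr (forall₂_congr fun S _ => ?_) ?_)
    · rw [← ENNReal.ofReal_coe_nnreal, ENNReal.ofReal_le_ofReal_iff (NNReal.coe_nonneg _)]
    · rw [coe_sum_le_ofReal_add_iff S R Cin (meanProfile_snd_nonneg q p W S)]
    · have h := coe_sum_le_ofReal_add_iff Finset.univ R 0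
        (div_nonneg (averageDiv_nonneg W Finset.univ (meanProfile_fst_nonneg q p W))
          (Real.log_pos one_lt_two).le)
      simpa using h.symm
  constructor
  · rintro ⟨m, q, p, h⟩
    have hq := real_singleton_mem_stdSimplex q
    exact ⟨meanProfile q p W, (convex_convexHull ℝ _).sum_mem (fun u _ => hq.1 u) hq.2
      fun u _ => subset_convexHull ℝ _ ⟨_, fun j _ => weights_mem_stdSimplex (p u) j, rfl⟩,
      (key m q p).2 h⟩
  · rintro ⟨c, hc, h⟩
    -- The finite index set of the convex combination serves as the alphabet of `U_0`, with the
    -- weights as its law.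
    obtain ⟨ι, _, w, z, hw0, hw1, hz, rfl⟩ := mem_convexHull_iff_exists_fintype.1 hc
    choose v hv hvz using hz
    let e := Fintype.equivFin ι
    have hw : (fun u => w (e.symm u)) ∈ stdSimplex ℝ (Fin (Fintype.card ι)) :=
      ⟨fun u => hw0 _, by rw [Equiv.sum_comp e.symm w, hw1]⟩
    obtain ⟨q, hq⟩ := exists_probabilityMeasure_real_singleton hw
    choose p hp using fun u j => exists_probabilityMeasure_real_singleton (hv (e.symm u) j trivial)
    have hmean : meanProfile q p W = ∑ i, w i • z i := by
      have hpw : ∀ u, weights (p u) = v (e.symm u) := fun u => by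
        ext j a
        exact hp u j a
      simp only [meanProfile, hq, hpw, hvz]
      exact Equiv.sum_comp e.symm fun i => w i • z i
    exact ⟨_, q, p, (key _ q p).1 (hmean ▸ h)⟩

/-- A convergent sequence of rate vectors has profile points in a compact hull; a subsequential
limit satisfies the limiting constraints, since these are continuous in the rates and the point. -/
theorem isClosed_outerRegion (b : ∀ j, X j → ℝ≥0) (Cin B : Fin k → ℝ≥0) :
    IsClosed (outerRegion W b Cin B) := by
  refine isClosed_of_closure_subset fun R hR => ?_
  obtain ⟨r, hr, hrR⟩ := mem_closure_iff_seq_limit.1 hR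
  choose c hc hcr using fun n => (mem_outerRegion_iff W).1 (hr n)
  obtain ⟨c₀, hc₀, φ, hφ, hlim⟩ := (isCompact_profileHull W).tendsto_subseq hc
  have hr' : ∀ j, Tendsto (fun n => ((r (φ n) j : ℝ≥0) : ℝ)) atTop (𝓝 (R j)) := fun j =>
    (NNReal.continuous_coe.tendsto _).comp
      ((tendsto_pi_nhds.1 hrR j).comp hφ.tendsto_atTop)
  have h1 : Tendsto (fun n => (c (φ n)).1) atTop (𝓝 c₀.1) := (continuous_fst.tendsto _).comp hlim
  have h2 : Tendsto (fun n => (c (φ n)).2) atTop (𝓝 c₀.2) := (continuous_snd.tendsto _).comp hlim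
  have h3 : Tendsto (fun n => averageDiv W Finset.univ (c (φ n)).1) atTop
      (𝓝 (averageDiv W Finset.univ c₀.1)) :=
    (continuousOn_averageDiv W Finset.univ _ (fst_mem_stdSimplex_of_mem_profileHull W hc₀)).tendsto.comp
      (tendsto_nhdsWithin_iff.2 ⟨h1, Eventually.of_forall fun n =>
        fst_mem_stdSimplex_of_mem_profileHull W (hc (φ n))⟩)
  refine (mem_outerRegion_iff W).2 ⟨c₀, hc₀, fun j => ?_, fun S hS => ?_, ?_⟩
  · exact le_of_tendsto (tendsto_finsetSum _ fun x _ => (tendsto_pi_nhds.1 h1 x).mul_const _)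
      (Eventually.of_forall fun n => (hcr (φ n)).1 j)
  · exact le_of_tendsto_of_tendsto' (tendsto_finsetSum _ fun j _ => hr' j)
      ((tendsto_pi_nhds.1 h2 S).add_const _) fun n => (hcr (φ n)).2.1 S hS
  · exact le_of_tendsto_of_tendsto' (tendsto_finsetSum _ fun j _ => hr' j)
      (h3.div_const _) fun n => (hcr (φ n)).2.2

end FiniteInputs

end MACCF

theorem mainTheorem4 {k : ℕ} {X : Fin k → Type*} {Y : Type*}
    [∀ j, MeasurableSpace (X j)] [∀ j, StandardBorelSpace (X j)] [∀ j, Nonempty (X j)]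
    [MeasurableSpace Y] [StandardBorelSpace Y] [Nonempty Y]
    (W : Kernel (∀ j, X j) Y) [IsMarkovKernel W]
    (b : ∀ j, X j → ℝ≥0) (hb : ∀ j, Measurable (b j)) (Cin Cout B : Fin k → ℝ≥0) :
    MACCF.capacityRegion W b Cin Cout B ⊆ closure (MACCF.outerRegion W b Cin B) ∧
      ((∀ j, Finite (X j)) →
        MACCF.capacityRegion W b Cin Cout B ⊆ MACCF.outerRegion W b Cin B) := by
  have h : MACCF.capacityRegion W b Cin Cout B ⊆ closure (MACCF.outerRegion W b Cin B) :=
    closure_minimal (fun R hR => MACCF.Achievable.mem_closure_outerRegion hb hR) isClosed_closure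
  refine ⟨h, fun _ => ?_⟩
  have := fun j => Fintype.ofFinite (X j)
  exact h.trans (MACCF.isClosed_outerRegion W b Cin B).closure_subset
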